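/- Work on $(\mathbb{C}^2)^{\otimes 4}$ with parties $A,B,C,D$. For an operator $\rho$ let $R(\rho)$ and $r(\rho)$ be its range and rank, and for a set $S$ of parties let $\rho^{T_S}$ be its partial transpose with respect to $S$. A state is a positive semidefinite matrix of trace one; it is PPT if $\rho^{T_S}\ge 0$ for all $S$, and symmetric if $R(\rho)$ is contained in the permutation-symmetric subspace. A PPT state $\rho$ is edge if there is no nonzero product vector $|e_1,e_2,e_3,e_4\rangle\in R(\rho)$ such that, for every $S$, the product vector obtained by complex conjugating (in the computational basis) the $e_k$ with $k\in S$ lies in $R(\rho^{T_S})$. The three-rank of $\rho$ is $(r(\rho),r(\rho^{T_A}),r(\rho^{T_{AB}}))$, and $\Sigma_t$ denotes the set of four-qubit PPT symmetric states of three-rank $t$. A property holds for generic elements of $\Sigma_t$ if there is a real polynomial $f$ in the real and imaginary parts of the matrix entries such that $\{\rho\in\Sigma_t: f(\rho)\neq0\}$ is dense in $\Sigma_t$ and the property holds for every $\rho\in\Sigma_t$ with $f(\rho)\ne 0$. **Theorem.** For every three-rank $t$ different from $(5,7,7)$ and $(5,7,8)$, generic elements $\rho$ of $\Sigma_t$ are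 not edge; moreover there is a nonzero $|e\rangle\in\mathbb{C}^2$ with $|e\rangle^{\otimes4}\in R(\rho)$, $|e^*,e,e,e\rangle\in R(\rho^{T_A})$ and $|e^*,e^*,e,e\rangle\in R(\rho^{T_{AB}})$. For $t=(5,8,8)$ the same holds for every $\rho\in\Sigma_t$, not only for generic ones. -/

import Mathlib

open scoped ComplexOrder

namespace QSym

/-- Index set of the computational basis of `(ℂ^d)^{⊗ N}`. -/
abbrev Idx (N d : ℕ) : Type := Fin N → Fin d

/-- Operators on `(ℂ^d)^{⊗ N}`, written in the computational basis. -/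
abbrev Op (N d : ℕ) : Type := Matrix (Idx N d) (Idx N d) ℂ

/-- The range `R(A)` of an operator. -/
noncomputable def rangeOf {N d : ℕ} (A : Op N d) : Submodule ℂ (Idx N d → ℂ) :=
  LinearMap.range A.mulVecLin

/-- The product vector `|e₁, …, e_N⟩`. -/
def prodVec {N d : ℕ} (e : Fin N → Fin d → ℂ) : Idx N d → ℂ :=
  fun i => ∏ k, e k (i k)

/-- Complex conjugation of the local vectors of the parties in `S`. -/
def conjOn {N d : ℕ} (S : Finset (Fin N)) (e : Fin N → Fin d → ℂ) : Fin N → Fin d → ℂ :=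
  fun k => if k ∈ S then star (e k) else e k

/-- The partial transposition `ρ^{T_S}`: row and column indices of the parties in `S` are
exchanged. -/
def partialTranspose {N d : ℕ} (S : Finset (Fin N)) (ρ : Op N d) : Op N d :=
  fun i j => ρ (fun k => if k ∈ S then j k else i k) (fun k => if k ∈ S then i k else j k)

/-- Density matrices. -/
def IsState {N d : ℕ} (ρ : Op N d) : Prop :=
  ρ.PosSemidef ∧ ρ.trace = 1

/-- PPT states: all partial transposes are positive semidefinite. -/
def IsPPT {N d : ℕ} (ρ : Op N d) : Prop :=
  IsState ρ ∧ ∀ S : Finset (Fin N), (partialTranspose S ρ).PosSemidef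

/-- Edge states: PPT states for which no (nonzero) product vector has, for every `S`, its partial
conjugation with respect to `S` in `R(ρ^{T_S})`; `S = ∅` is the condition on `R(ρ)`. -/
def IsEdge {N d : ℕ} (ρ : Op N d) : Prop :=
  IsPPT ρ ∧ ¬ ∃ e : Fin N → Fin d → ℂ, (∀ k, e k ≠ 0) ∧
    ∀ S : Finset (Fin N), prodVec (conjOn S e) ∈ rangeOf (partialTranspose S ρ)

/-- The symmetric subspace of `(ℂ^d)^{⊗ N}`. -/
def symSubspace (N d : ℕ) : Submodule ℂ (Idx N d → ℂ) where
  carrier := {v | ∀ (π : Equiv.Perm (Fin N)) (i : Idx N d), v (i ∘ π) = v i}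
  add_mem' := fun ha hb π i => by simp [ha π i, hb π i]
  zero_mem' := fun _ _ => rfl
  smul_mem' := fun c _ ha π i => by simp [ha π i]

/-- Symmetric operators: `R(ρ)` is contained in the symmetric subspace. -/
def IsSymm {N d : ℕ} (ρ : Op N d) : Prop :=
  rangeOf ρ ≤ symSubspace N d

/-- The three-rank `(r(ρ), r(ρ^{T_A}), r(ρ^{T_AB}))` of a four-qubit operator. -/
noncomputable def threeRank (ρ : Op 4 2) : ℕ × ℕ × ℕ :=
  (ρ.rank, (partialTranspose {0} ρ).rank, (partialTranspose {0, 1} ρ).rank)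

/-- The four-qubit PPT symmetric states of three-rank `t`. -/
def pptSymOfRank (t : ℕ × ℕ × ℕ) : Set (Op 4 2) :=
  {ρ | IsPPT ρ ∧ IsSymm ρ ∧ threeRank ρ = t}

/-- There is a symmetric product vector `|e⟩^{⊗4} ∈ R(ρ)` with `|e*, e, e, e⟩ ∈ R(ρ^{T_A})` and
`|e*, e*, e, e⟩ ∈ R(ρ^{T_AB})`. -/
def HasSymProductVector (ρ : Op 4 2) : Prop :=
  ∃ e : Fin 2 → ℂ, e ≠ 0 ∧
    prodVec ![e, e, e, e] ∈ rangeOf ρ ∧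
    prodVec ![star e, e, e, e] ∈ rangeOf (partialTranspose {0} ρ) ∧
    prodVec ![star e, star e, e, e] ∈ rangeOf (partialTranspose {0, 1} ρ)

/-- Real polynomials in the real and imaginary parts of the matrix entries. -/
abbrev EntryPoly (N d : ℕ) : Type :=
  MvPolynomial ((Idx N d × Idx N d) ⊕ (Idx N d × Idx N d)) ℝ

/-- The value of such a polynomial at `ρ`. -/
noncomputable def EntryPoly.at {N d : ℕ} (f : EntryPoly N d) (ρ : Op N d) : ℝ :=
  MvPolynomial.eval (Sum.elim (fun p => (ρ p.1 p.2).re) (fun p => (ρ p.1 p.2).im)) f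

/-- `P` holds for generic elements of `T`: it holds at every element of `T` at which some fixed
real polynomial does not vanish, and the elements with nonvanishing value are dense in `T`
(so the exceptional elements lie in an algebraic subset that is nowhere dense in `T`). -/
def HoldsGenerically {N d : ℕ} (T : Set (Op N d)) (P : Op N d → Prop) : Prop :=
  ∃ f : EntryPoly N d,
    T ⊆ closure {ρ | ρ ∈ T ∧ f.at ρ ≠ 0} ∧ ∀ ρ ∈ T, f.at ρ ≠ 0 → P ρ

end QSym

/-! The entries of a symmetric ρ depend only on the weights of the two indices, so ρ is a linear
functional L on forms of bidegree (4,4) in x = (x₀,x₁) and y = (y₀,y₁), where y stands for the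
conjugate of x. The partial transpose over n parties is, up to repeated rows and columns, the Gram
matrix of (f, g) ↦ L(f ḡ) on forms of bidegree (4-n, n). PPT thus means that L(|f|²) ≥ 0 in every
bidegree of total degree 4, and the kernels in bidegrees (4,0), (3,1), (2,2) have dimensions 5, 8, 9
minus the entries of the three-rank. The required vectors exist as soon as all kernel forms vanish
at one point (e, ē), e ≠ 0 (`HasRealZero`).

The engine is `annih_or_evalAt_eq_zero`. Since |x₁f|² = |y₁f|² as polynomials, positivity shows that
y₁f is annihilated by L whenever x₁f is. Then h ↦ L(fh) is a multiple of the evaluation at (1,0). If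
the multiple is nonzero, kernel forms in all bidegrees within reach vanish at (1,0); if it is zero,
f itself is annihilated and the degree has dropped. This descent settles large kernels: a nonzero
form of bidegree (4,0) (`hasRealZero_of_quartic`), and two independent forms of bidegree (3,1) or
three of bidegree (2,2), where a determinant supplies a combination divisible by a linear form in x
and the descent runs through annihilated forms of bidegrees (2,1) and (1,1).

Small kernels remain, with trivial (4,0) part. If only bidegree (3,1) has a kernel, of dimension
one, its form has a real zero because its winding number at infinity is 3 - 1 ≠ 0
(`exists_real_zero_three_one`). If only bidegree (2,2) has one, of dimension one, a real form spans
it, and its mean over a suitable set of real points is zero, so it cannot have constant sign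
(`exists_real_zero_of_annih`). If that dimension is two, a common complex zero of the pencil is
real, or yields a real one, or else produces a kernel form of bidegree (3,1)
(`hasRealZero_of_pencil`). Only the dimensions (0,1,1) and (0,1,2) are left, which are the
three-ranks (5,7,8) and (5,7,7). No genericity is used: the conclusion holds for every state of any
other three-rank. -/

namespace QSym

open MvPolynomial

/-! ### Bihomogeneous polynomials -/

/-- Polynomials in `x₀, x₁` (variables `0, 1`) and `y₀, y₁` (variables `2, 3`); the latter stand
for the complex conjugates of the former. -/
abbrev BiPoly : Type := MvPolynomial (Fin 4) ℂ

local notation "x₀" => (X 0 : BiPoly)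
local notation "x₁" => (X 1 : BiPoly)
local notation "y₀" => (X 2 : BiPoly)
local notation "y₁" => (X 3 : BiPoly)

/-- The monomial `x₀^(m-i) x₁^i y₀^(n-j) y₁^j`. -/
noncomputable def biMon (m n i j : ℕ) : BiPoly :=
  x₀ ^ (m - i) * x₁ ^ i * (y₀ ^ (n - j) * y₁ ^ j)

/-- Bihomogeneous polynomials of bidegree `(m, n)`. -/
noncomputable def bihom (m n : ℕ) : Submodule ℂ BiPoly :=
  Submodule.span ℂ {f | ∃ i j, i ≤ m ∧ j ≤ n ∧ f = biMon m n i j}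

theorem biMon_mem {m n i j : ℕ} (hi : i ≤ m) (hj : j ≤ n) : biMon m n i j ∈ bihom m n :=
  Submodule.subset_span ⟨i, j, hi, hj, rfl⟩

theorem C_mul_mem {m n : ℕ} (c : ℂ) {f : BiPoly} (hf : f ∈ bihom m n) : C c * f ∈ bihom m n := by
  rw [C_mul']; exact Submodule.smul_mem _ _ hf

@[elab_as_elim]
theorem bihom_induction {m n : ℕ} {p : (f : BiPoly) → f ∈ bihom m n → Prop}
    (mon : ∀ i j (hi : i ≤ m) (hj : j ≤ n), p (biMon m n i j) (biMon_mem hi hj))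
    (add : ∀ f g hf hg, p f hf → p g hg → p (f + g) (add_mem hf hg))
    (zero : p 0 (zero_mem _))
    (smul : ∀ (c : ℂ) f hf, p f hf → p (C c * f) (C_mul_mem c hf)) {f : BiPoly}
    (hf : f ∈ bihom m n) : p f hf := by
  induction hf using Submodule.span_induction with
  | mem f h => obtain ⟨i, j, hi, hj, rfl⟩ := h; exact mon i j hi hj
  | zero => exact zero
  | add f g _ _ h1 h2 => exact add f g _ _ h1 h2
  | smul c f _ h => simp only [← C_mul']; exact smul c f _ h

theorem biMon_mul {m n i j m' n' i' j' : ℕ} (hi : i ≤ m) (hj : j ≤ n) (hi' : i' ≤ m')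
    (hj' : j' ≤ n') :
    biMon m n i j * biMon m' n' i' j' = biMon (m + m') (n + n') (i + i') (j + j') := by
  unfold biMon
  rw [show m + m' - (i + i') = (m - i) + (m' - i') by omega,
    show n + n' - (j + j') = (n - j) + (n' - j') by omega]
  ring

theorem bihom_mul {m n m' n' M N : ℕ} {f g : BiPoly} (hf : f ∈ bihom m n) (hg : g ∈ bihom m' n')
    (hM : m + m' = M := by omega) (hN : n + n' = N := by omega) : f * g ∈ bihom M N := by
  subst hM hN
  induction hf using bihom_induction with
  | mon i j hi hj =>
    induction hg using bihom_induction with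
    | mon i' j' hi' hj' =>
      rw [biMon_mul hi hj hi' hj']; exact biMon_mem (by omega) (by omega)
    | add f g _ _ h1 h2 => rw [mul_add]; exact add_mem h1 h2
    | zero => rw [mul_zero]; exact zero_mem _
    | smul c f _ h => rw [mul_left_comm]; exact C_mul_mem c h
  | add f g _ _ h1 h2 => rw [add_mul]; exact add_mem h1 h2
  | zero => rw [zero_mul]; exact zero_mem _
  | smul c f _ h => rw [mul_assoc]; exact C_mul_mem c h

theorem x0_mem : x₀ ∈ bihom 1 0 := by
  simpa [biMon] using biMon_mem (m := 1) (n := 0) (i := 0) (j := 0) (by omega) (by omega)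

theorem x1_mem : x₁ ∈ bihom 1 0 := by
  simpa [biMon] using biMon_mem (m := 1) (n := 0) (i := 1) (j := 0) (by omega) (by omega)

theorem y0_mem : y₀ ∈ bihom 0 1 := by
  simpa [biMon] using biMon_mem (m := 0) (n := 1) (i := 0) (j := 0) (by omega) (by omega)

theorem y1_mem : y₁ ∈ bihom 0 1 := by
  simpa [biMon] using biMon_mem (m := 0) (n := 1) (i := 0) (j := 1) (by omega) (by omega)

theorem C_mem (c : ℂ) : (C c : BiPoly) ∈ bihom 0 0 := by
  have h := biMon_mem (m := 0) (n := 0) (i := 0) (j := 0) (by omega) (by omega)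
  simpa [biMon] using C_mul_mem c h

theorem bihom_pow {m n M N : ℕ} {f : BiPoly} (hf : f ∈ bihom m n) (k : ℕ)
    (hM : k * m = M := by omega) (hN : k * n = N := by omega) : f ^ k ∈ bihom M N := by
  subst hM hN
  induction k with
  | zero => simpa using C_mem 1
  | succ k ih =>
    rw [pow_succ]
    exact bihom_mul ih hf (by ring) (by ring)

theorem bihom_prod {ι : Type*} (s : Finset ι) {f : ι → BiPoly} {m n : ι → ℕ}
    (hf : ∀ i ∈ s, f i ∈ bihom (m i) (n i)) :
    ∏ i ∈ s, f i ∈ bihom (∑ i ∈ s, m i) (∑ i ∈ s, n i) := by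
  classical
  induction s using Finset.induction_on with
  | empty => simpa using C_mem 1
  | insert a s ha ih =>
    rw [Finset.prod_insert ha, Finset.sum_insert ha, Finset.sum_insert ha]
    exact bihom_mul (hf a (Finset.mem_insert_self a s))
      (ih fun i hi => hf i (Finset.mem_insert_of_mem hi)) rfl rfl

theorem x0_pow_mem (k : ℕ) : x₀ ^ k ∈ bihom k 0 :=
  bihom_pow x0_mem k (mul_one k) (mul_zero k)

theorem x1_pow_mem (k : ℕ) : x₁ ^ k ∈ bihom k 0 :=
  bihom_pow x1_mem k (mul_one k) (mul_zero k)

theorem y0_pow_mem (k : ℕ) : y₀ ^ k ∈ bihom 0 k :=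
  bihom_pow y0_mem k (mul_zero k) (mul_one k)

theorem y1_pow_mem (k : ℕ) : y₁ ^ k ∈ bihom 0 k :=
  bihom_pow y1_mem k (mul_zero k) (mul_one k)

theorem x0_pow_mul_y0_pow_mem (a b : ℕ) : x₀ ^ a * y₀ ^ b ∈ bihom a b :=
  bihom_mul (x0_pow_mem a) (y0_pow_mem b) (by omega) (by omega)

/-- The bihomogeneous polynomial with given coefficients. -/
noncomputable def polyOf (m n : ℕ) (c : Fin (m + 1) × Fin (n + 1) → ℂ) : BiPoly :=
  ∑ p, C (c p) * biMon m n p.1 p.2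

theorem polyOf_mem {m n : ℕ} (c : Fin (m + 1) × Fin (n + 1) → ℂ) : polyOf m n c ∈ bihom m n :=
  sum_mem fun p _ => C_mul_mem _ (biMon_mem (by omega) (by omega))

theorem exists_eq_polyOf {m n : ℕ} {f : BiPoly} (hf : f ∈ bihom m n) :
    ∃ c, f = polyOf m n c := by
  induction hf using bihom_induction with
  | mon i j hi hj =>
    refine ⟨Pi.single (⟨i, by omega⟩, ⟨j, by omega⟩) 1, ?_⟩
    rw [polyOf, Finset.sum_eq_single (⟨i, by omega⟩, ⟨j, by omega⟩)]
    · simp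
    · intro b _ hb; simp [Pi.single_eq_of_ne hb]
    · simp
  | add f g _ _ h1 h2 =>
    obtain ⟨c, rfl⟩ := h1
    obtain ⟨d, rfl⟩ := h2
    exact ⟨c + d, by simp [polyOf, add_mul, Finset.sum_add_distrib]⟩
  | zero => exact ⟨0, by simp [polyOf]⟩
  | smul a f _ h =>
    obtain ⟨c, rfl⟩ := h
    exact ⟨a • c, by simp [polyOf, Finset.mul_sum, mul_assoc]⟩

theorem biMon_eq_monomial (m n i j : ℕ) :
    biMon m n i j = monomial (Finsupp.equivFunOnFinite.symm ![m - i, i, n - j, j]) 1 := by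
  rw [monomial_eq, biMon]
  simp [Finsupp.prod_fintype, Fin.prod_univ_four, mul_assoc]

theorem polyOf_injective (m n : ℕ) : Function.Injective (polyOf m n) := by
  intro c d h
  funext ⟨i, j⟩
  have key : ∀ c : Fin (m + 1) × Fin (n + 1) → ℂ,
      coeff (Finsupp.equivFunOnFinite.symm ![m - i, (i : ℕ), n - j, (j : ℕ)]) (polyOf m n c)
        = c (i, j) := by
    intro c
    rw [polyOf, coeff_sum, Finset.sum_eq_single (i, j)]
    · rw [coeff_C_mul, biMon_eq_monomial, coeff_monomial, if_pos rfl, mul_one]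
    · rintro ⟨i', j'⟩ _ hne
      rw [coeff_C_mul, biMon_eq_monomial, coeff_monomial, if_neg, mul_zero]
      intro h
      apply hne
      have h1 := congrArg (fun f => f 1) h
      have h3 := congrArg (fun f => f 3) h
      simp at h1 h3
      ext <;> simp [h1, h3]
    · simp
  rw [← key c, ← key d, h]

/-! ### Conjugation, evaluation and linear substitutions -/

/-- Complex conjugation of polynomials: it conjugates coefficients and exchanges `x` and `y`. -/
noncomputable def conjP : BiPoly →+* BiPoly :=
  eval₂Hom (C.comp (starRingEnd ℂ)) ![y₀, y₁, x₀, x₁]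

@[simp] theorem conjP_C (c : ℂ) : conjP (C c) = C (starRingEnd ℂ c) := by simp [conjP]
@[simp] theorem conjP_x0 : conjP x₀ = y₀ := by simp [conjP]
@[simp] theorem conjP_x1 : conjP x₁ = y₁ := by simp [conjP]
@[simp] theorem conjP_y0 : conjP y₀ = x₀ := by simp [conjP]
@[simp] theorem conjP_y1 : conjP y₁ = x₁ := by simp [conjP]

@[simp] theorem conjP_conjP (f : BiPoly) : conjP (conjP f) = f := by
  have : (conjP.comp conjP) = RingHom.id BiPoly := by
    apply MvPolynomial.ringHom_ext
    · intro r; simp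
    · intro i; fin_cases i <;> simp
  exact congrArg (fun φ => φ f) this

theorem conjP_biMon (m n i j : ℕ) : conjP (biMon m n i j) = biMon n m j i := by
  simp [biMon]; ring

theorem conjP_mem {m n : ℕ} {f : BiPoly} (hf : f ∈ bihom m n) : conjP f ∈ bihom n m := by
  induction hf using bihom_induction with
  | mon i j hi hj => rw [conjP_biMon]; exact biMon_mem hj hi
  | add f g _ _ h1 h2 => rw [map_add]; exact add_mem h1 h2
  | zero => rw [map_zero]; exact zero_mem _
  | smul c f _ h => rw [map_mul, conjP_C]; exact C_mul_mem _ h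

theorem conjP_polyOf {m n : ℕ} (c : Fin (m + 1) × Fin (n + 1) → ℂ) :
    conjP (polyOf m n c) = polyOf n m fun p => starRingEnd ℂ (c (p.2, p.1)) := by
  simp only [polyOf, map_sum, map_mul, conjP_C, conjP_biMon]
  exact (Fintype.sum_equiv (Equiv.prodComm _ _) _ _ fun p => by simp)

/-- Evaluation at `x = a`, `y = b`. -/
noncomputable def evalAt (a b : Fin 2 → ℂ) : BiPoly →ₐ[ℂ] ℂ := aeval ![a 0, a 1, b 0, b 1]

@[simp] theorem evalAt_C (a b : Fin 2 → ℂ) (c : ℂ) : evalAt a b (C c) = c := by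
  simp [evalAt]
@[simp] theorem evalAt_x0 (a b : Fin 2 → ℂ) : evalAt a b x₀ = a 0 := by simp [evalAt]
@[simp] theorem evalAt_x1 (a b : Fin 2 → ℂ) : evalAt a b x₁ = a 1 := by simp [evalAt]
@[simp] theorem evalAt_y0 (a b : Fin 2 → ℂ) : evalAt a b y₀ = b 0 := by simp [evalAt]
@[simp] theorem evalAt_y1 (a b : Fin 2 → ℂ) : evalAt a b y₁ = b 1 := by simp [evalAt]

theorem evalAt_conjP (a b : Fin 2 → ℂ) (f : BiPoly) :
    evalAt a b (conjP f) = starRingEnd ℂ (evalAt (star b) (star a) f) := by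
  have : ((evalAt a b : BiPoly →+* ℂ).comp conjP)
      = (starRingEnd ℂ).comp (evalAt (star b) (star a) : BiPoly →+* ℂ) := by
    apply MvPolynomial.ringHom_ext
    · intro r; simp
    · intro i; fin_cases i <;> simp
  exact congrArg (fun φ => φ f) this

/-- Partial evaluation at `x = a`. -/
noncomputable def evalX (a : Fin 2 → ℂ) : BiPoly →ₐ[ℂ] BiPoly :=
  aeval ![C (a 0), C (a 1), y₀, y₁]

@[simp] theorem evalX_C (a : Fin 2 → ℂ) (c : ℂ) : evalX a (C c) = C c := by
  rw [← algebraMap_eq, AlgHom.commutes]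
@[simp] theorem evalX_x0 (a : Fin 2 → ℂ) : evalX a x₀ = C (a 0) := by simp [evalX]
@[simp] theorem evalX_x1 (a : Fin 2 → ℂ) : evalX a x₁ = C (a 1) := by simp [evalX]
@[simp] theorem evalX_y0 (a : Fin 2 → ℂ) : evalX a y₀ = y₀ := by simp [evalX]
@[simp] theorem evalX_y1 (a : Fin 2 → ℂ) : evalX a y₁ = y₁ := by simp [evalX]

theorem evalAt_evalX (a b c : Fin 2 → ℂ) (f : BiPoly) :
    evalAt c b (evalX a f) = evalAt a b f := by
  have : (evalAt c b).comp (evalX a) = evalAt a b := by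
    apply MvPolynomial.algHom_ext
    intro i; fin_cases i <;> simp
  exact congrArg (fun φ => φ f) this

/-- The linear change of coordinates `x ↦ A x`, `y ↦ conj A y`. -/
noncomputable def subst (A : Matrix (Fin 2) (Fin 2) ℂ) : BiPoly →ₐ[ℂ] BiPoly :=
  aeval ![C (A 0 0) * x₀ + C (A 0 1) * x₁, C (A 1 0) * x₀ + C (A 1 1) * x₁,
    C (starRingEnd ℂ (A 0 0)) * y₀ + C (starRingEnd ℂ (A 0 1)) * y₁,
    C (starRingEnd ℂ (A 1 0)) * y₀ + C (starRingEnd ℂ (A 1 1)) * y₁]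

section subst
variable (A : Matrix (Fin 2) (Fin 2) ℂ)

@[simp] theorem subst_C (c : ℂ) : subst A (C c) = C c := by
  rw [← algebraMap_eq, AlgHom.commutes]
@[simp] theorem subst_x0 : subst A x₀ = C (A 0 0) * x₀ + C (A 0 1) * x₁ := by simp [subst]
@[simp] theorem subst_x1 : subst A x₁ = C (A 1 0) * x₀ + C (A 1 1) * x₁ := by simp [subst]
@[simp] theorem subst_y0 :
    subst A y₀ = C (starRingEnd ℂ (A 0 0)) * y₀ + C (starRingEnd ℂ (A 0 1)) * y₁ := by
  simp [subst]
@[simp] theorem subst_y1 :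
    subst A y₁ = C (starRingEnd ℂ (A 1 0)) * y₀ + C (starRingEnd ℂ (A 1 1)) * y₁ := by
  simp [subst]

theorem subst_subst (B : Matrix (Fin 2) (Fin 2) ℂ) (f : BiPoly) :
    subst A (subst B f) = subst (B * A) f := by
  have : (subst A).comp (subst B) = subst (B * A) := by
    apply MvPolynomial.algHom_ext
    intro i
    fin_cases i <;> simp [Matrix.mul_apply, Fin.sum_univ_two] <;> ring
  exact congrArg (fun φ => φ f) this

theorem subst_one (f : BiPoly) : subst 1 f = f := by
  have : subst 1 = AlgHom.id ℂ BiPoly := by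
    apply MvPolynomial.algHom_ext
    intro i
    fin_cases i <;> simp
  exact congrArg (fun φ => φ f) this

theorem conjP_subst (f : BiPoly) : conjP (subst A f) = subst A (conjP f) := by
  have : conjP.comp (subst A : BiPoly →+* BiPoly) = (subst A : BiPoly →+* BiPoly).comp conjP := by
    apply MvPolynomial.ringHom_ext
    · intro r; simp
    · intro i; fin_cases i <;> simp
  exact congrArg (fun φ => φ f) this

theorem subst_mem {m n : ℕ} {f : BiPoly} (hf : f ∈ bihom m n) : subst A f ∈ bihom m n := by
  induction hf using bihom_induction with
  | mon i j hi hj =>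
    have hx0 : subst A x₀ ∈ bihom 1 0 := by
      rw [subst_x0]; exact add_mem (C_mul_mem _ x0_mem) (C_mul_mem _ x1_mem)
    have hx1 : subst A x₁ ∈ bihom 1 0 := by
      rw [subst_x1]; exact add_mem (C_mul_mem _ x0_mem) (C_mul_mem _ x1_mem)
    have hy0 : subst A y₀ ∈ bihom 0 1 := by
      rw [subst_y0]; exact add_mem (C_mul_mem _ y0_mem) (C_mul_mem _ y1_mem)
    have hy1 : subst A y₁ ∈ bihom 0 1 := by
      rw [subst_y1]; exact add_mem (C_mul_mem _ y0_mem) (C_mul_mem _ y1_mem)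
    simp only [biMon, map_mul, map_pow]
    refine bihom_mul (m := m) (n := 0) (m' := 0) (n' := n) ?_ ?_
    · exact bihom_mul (bihom_pow hx0 (m - i) rfl rfl) (bihom_pow hx1 i rfl rfl)
    · exact bihom_mul (bihom_pow hy0 (n - j) rfl rfl) (bihom_pow hy1 j rfl rfl)
  | add f g _ _ h1 h2 => rw [map_add]; exact add_mem h1 h2
  | zero => rw [map_zero]; exact zero_mem _
  | smul c f _ h => rw [map_mul, subst_C]; exact C_mul_mem _ h

theorem evalAt_subst (a : Fin 2 → ℂ) (f : BiPoly) :
    evalAt a (star a) (subst A f) = evalAt (A.mulVec a) (star (A.mulVec a)) f := by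
  have : (evalAt a (star a)).comp (subst A) = evalAt (A.mulVec a) (star (A.mulVec a)) := by
    apply MvPolynomial.algHom_ext
    intro i
    fin_cases i <;> simp
  exact congrArg (fun φ => φ f) this

theorem evalX_subst (a : Fin 2 → ℂ) (f : BiPoly) :
    evalX a (subst A f) = subst A (evalX (A.mulVec a) f) := by
  have : (evalX a).comp (subst A) = (subst A).comp (evalX (A.mulVec a)) := by
    apply MvPolynomial.algHom_ext
    intro i
    fin_cases i <;> simp
  exact congrArg (fun φ => φ f) this

theorem subst_injective (hA : IsUnit A.det) : Function.Injective (subst A) := by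
  intro f g h
  have := congrArg (subst A⁻¹) h
  rwa [subst_subst, subst_subst, Matrix.mul_nonsing_inv _ hA, subst_one, subst_one] at this

end subst

theorem exists_matrix_mulVec_eq {e : Fin 2 → ℂ} (he : e ≠ 0) :
    ∃ A : Matrix (Fin 2) (Fin 2) ℂ, IsUnit A.det ∧ A.mulVec ![1, 0] = e := by
  by_cases h : e 0 = 0
  · have h1 : e 1 ≠ 0 := by
      intro h1; apply he; funext i; fin_cases i <;> simp [h, h1]
    refine ⟨!![e 0, 1; e 1, 0], by simp [Matrix.det_fin_two, h1], ?_⟩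
    funext i; fin_cases i <;> simp
  · refine ⟨!![e 0, 0; e 1, 1], by simp [Matrix.det_fin_two, h], ?_⟩
    funext i; fin_cases i <;> simp

/-! ### Linear factors and zeros of binary forms -/

/-- Division with remainder by `x₁`. -/
theorem exists_eq_x1_mul_add {m n : ℕ} {f : BiPoly} (hf : f ∈ bihom (m + 1) n) :
    ∃ g ∈ bihom m n, f = x₁ * g + x₀ ^ (m + 1) * evalX ![1, 0] f := by
  induction hf using bihom_induction with
  | mon i j hi hj =>
    rcases i with _ | i
    · exact ⟨0, zero_mem _, by simp [biMon]⟩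
    · refine ⟨biMon m n i j, biMon_mem (by omega) hj, ?_⟩
      have : evalX ![1, 0] (biMon (m + 1) n (i + 1) j) = 0 := by simp [biMon]
      rw [this]
      simp only [biMon, show m + 1 - (i + 1) = m - i by omega]
      ring
  | add f g _ _ h1 h2 =>
    obtain ⟨a, ha, ha'⟩ := h1
    obtain ⟨b, hb, hb'⟩ := h2
    refine ⟨a + b, add_mem ha hb, ?_⟩
    rw [map_add]
    linear_combination ha' + hb'
  | zero => exact ⟨0, zero_mem _, by simp⟩
  | smul c f _ h =>
    obtain ⟨a, ha, ha'⟩ := h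
    refine ⟨C c * a, C_mul_mem c ha, ?_⟩
    rw [map_mul, evalX_C]
    linear_combination C c * ha'

theorem exists_eq_x1_mul {m n : ℕ} {f : BiPoly} (hf : f ∈ bihom (m + 1) n)
    (h : evalX ![1, 0] f = 0) : ∃ g ∈ bihom m n, f = x₁ * g := by
  obtain ⟨g, hg, e⟩ := exists_eq_x1_mul_add hf
  exact ⟨g, hg, by rwa [h, mul_zero, add_zero] at e⟩

/-- Coefficients with respect to the `y` variables. -/
theorem exists_eq_sum_y {m n : ℕ} {f : BiPoly} (hf : f ∈ bihom m n) :
    ∃ F : Fin (n + 1) → BiPoly, (∀ j, F j ∈ bihom m 0) ∧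
      f = ∑ j : Fin (n + 1), F j * (y₀ ^ (n - j) * y₁ ^ (j : ℕ)) := by
  obtain ⟨c, rfl⟩ := exists_eq_polyOf hf
  refine ⟨fun j => ∑ i : Fin (m + 1), C (c (i, j)) * biMon m 0 i 0, fun j =>
    sum_mem fun i _ => C_mul_mem _ (biMon_mem (by omega) le_rfl), ?_⟩
  rw [polyOf, Fintype.sum_prod_type_right]
  refine Finset.sum_congr rfl fun j _ => ?_
  rw [Finset.sum_mul]
  refine Finset.sum_congr rfl fun i _ => ?_
  simp [biMon]; ring

theorem evalX_of_mem {m : ℕ} {F : BiPoly} (hF : F ∈ bihom m 0) (a b : Fin 2 → ℂ) :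
    evalX a F = C (evalAt a b F) := by
  induction hF using bihom_induction with
  | mon i j hi hj =>
    obtain rfl : j = 0 := by omega
    simp [biMon]
  | add f g _ _ h1 h2 => simp [h1, h2]
  | zero => simp
  | smul c f _ h => simp [h]

/-- A binary form of positive degree has a nontrivial zero. -/
theorem exists_zero_of_mem {m : ℕ} (hm : m ≠ 0) {F : BiPoly} (hF : F ∈ bihom m 0) :
    ∃ e : Fin 2 → ℂ, e ≠ 0 ∧ ∀ b, evalAt e b F = 0 := by
  obtain ⟨c, rfl⟩ := exists_eq_polyOf hF
  have hev : ∀ e b : Fin 2 → ℂ, evalAt e b (polyOf m 0 c)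
      = ∑ i : Fin (m + 1), c (i, 0) * (e 0 ^ (m - i) * e 1 ^ (i : ℕ)) := by
    intro e b
    simp [polyOf, Fintype.sum_prod_type, biMon]
  -- If the coefficient of x₁^m vanishes, (0,1) is a zero; otherwise setting x₀ = 1 gives a
  -- polynomial of exact degree m, which has a root.
  by_cases hc : c (Fin.last m, 0) = 0
  · refine ⟨![0, 1], fun h => by simpa using congrFun h 1, fun b => ?_⟩
    rw [hev]
    refine Finset.sum_eq_zero fun i _ => ?_
    by_cases hi : i = Fin.last m
    · rw [hi, hc, zero_mul]
    · have : m - (i : ℕ) ≠ 0 := by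
        have := Fin.val_lt_last hi; omega
      simp [this]
  · set p : Polynomial ℂ := ∑ i : Fin (m + 1), Polynomial.C (c (i, 0)) * Polynomial.X ^ (i : ℕ)
      with hp
    have hcoeff : p.coeff m = c (Fin.last m, 0) := by
      rw [hp, Polynomial.finsetSum_coeff, Finset.sum_eq_single (Fin.last m)]
      · simp
      · intro i _ hi
        have := Fin.val_lt_last hi
        simp [Polynomial.coeff_X_pow]
        intro h; omega
      · simp
    have hdeg : p.degree ≠ 0 := by
      intro h
      have h2 := Polynomial.coeff_eq_zero_of_degree_lt (p := p) (n := m)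
        (by rw [h]; exact_mod_cast Nat.pos_of_ne_zero hm)
      exact hc (hcoeff ▸ h2)
    obtain ⟨t, ht⟩ := Complex.isAlgClosed.exists_root p hdeg
    refine ⟨![1, t], fun h => by simpa using congrFun h 0, fun b => ?_⟩
    rw [hev]
    simpa [hp, Polynomial.IsRoot, Polynomial.eval_finsetSum] using ht

/-- A family of `n + 1` forms of bidegrees `(m a, n)` becomes linearly dependent at some point. -/
theorem exists_dependent_evalX {n : ℕ} {m : Fin (n + 1) → ℕ} (hm : ∑ a, m a ≠ 0)
    {k : Fin (n + 1) → BiPoly} (hk : ∀ a, k a ∈ bihom (m a) n) :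
    ∃ e : Fin 2 → ℂ, e ≠ 0 ∧ ∃ c : Fin (n + 1) → ℂ, c ≠ 0 ∧
      ∑ a, C (c a) * evalX e (k a) = 0 := by
  choose F hF hkF using fun a => exists_eq_sum_y (hk a)
  -- Each Leibniz term takes one coefficient from each of the forms, so the determinant is a binary
  -- form in x of degree ∑ m a. At a zero of it the rows of coefficients are dependent.
  have hdet : (Matrix.of F).det ∈ bihom (∑ a, m a) 0 := by
    rw [← Matrix.det_transpose, Matrix.det_apply]
    refine sum_mem fun σ _ => ?_
    have h1 : ∏ i, F i (σ i) ∈ bihom (∑ a, m a) 0 := by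
      simpa using bihom_prod Finset.univ (n := fun _ => 0) fun i _ => hF i (σ i)
    rcases Int.units_eq_one_or (Equiv.Perm.sign σ) with h | h
    · simpa [h] using h1
    · simpa [h] using neg_mem h1
  obtain ⟨e, he, hz⟩ := exists_zero_of_mem hm hdet
  refine ⟨e, he, ?_⟩
  have h2 : ((Matrix.of F).map (evalAt e 0)).det = 0 := by
    have h3 := AlgHom.map_det (evalAt e 0) (Matrix.of F)
    rw [hz] at h3
    exact h3.symm
  obtain ⟨c, hc, hc'⟩ := Matrix.exists_vecMul_eq_zero_iff.mpr h2
  refine ⟨c, hc, ?_⟩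
  have h4 : ∀ j, ∑ a, c a * evalAt e 0 (F a j) = 0 := fun j => by
    simpa [Matrix.vecMul, dotProduct] using congrFun hc' j
  calc ∑ a, C (c a) * evalX e (k a)
      = ∑ a, ∑ j : Fin (n + 1), C (c a) * (C (evalAt e 0 (F a j)) *
          (y₀ ^ (n - j) * y₁ ^ (j : ℕ))) := by
        refine Finset.sum_congr rfl fun a _ => ?_
        conv_lhs => rw [hkF a]
        rw [map_sum, Finset.mul_sum]
        refine Finset.sum_congr rfl fun j _ => ?_
        rw [map_mul, evalX_of_mem (hF a j) e 0]
        simp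
    _ = ∑ j : Fin (n + 1), C (∑ a, c a * evalAt e 0 (F a j)) *
          (y₀ ^ (n - j) * y₁ ^ (j : ℕ)) := by
        rw [Finset.sum_comm]
        refine Finset.sum_congr rfl fun j _ => ?_
        simp only [map_sum, map_mul, Finset.sum_mul, mul_assoc]
    _ = 0 := by simp [h4]

theorem exists_eq_x0_mul {m n : ℕ} {f : BiPoly} (hf : f ∈ bihom (m + 1) n)
    (h : evalX ![0, 1] f = 0) : ∃ g ∈ bihom m n, f = x₀ * g := by
  set S : Matrix (Fin 2) (Fin 2) ℂ := !![0, 1; 1, 0] with hS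
  have hSS : S * S = 1 := by
    rw [hS]; ext i j; fin_cases i <;> fin_cases j <;> simp [Matrix.mul_apply]
  have hS1 : S.mulVec ![1, 0] = ![0, 1] := by
    rw [hS]; funext i; fin_cases i <;> simp
  obtain ⟨g, hg, e⟩ := exists_eq_x1_mul (subst_mem S hf) (by rw [evalX_subst, hS1, h, map_zero])
  refine ⟨subst S g, subst_mem S hg, ?_⟩
  have h2 := congrArg (subst S) e
  rw [subst_subst, hSS, subst_one] at h2
  rw [h2, map_mul, subst_x1, hS]
  simp

/-! ### Positive functionals, their kernels and the dichotomy -/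

/-- The linear functionals on polynomials induced by PPT symmetric states: they are real and
nonnegative on the squared moduli of forms of bidegree `(m, n)` with `m + n = 4`. -/
structure IsPPTFunctional (L : BiPoly →ₗ[ℂ] ℂ) : Prop where
  conj : ∀ f, L (conjP f) = starRingEnd ℂ (L f)
  nonneg : ∀ {m n : ℕ} {f : BiPoly}, m + n = 4 → f ∈ bihom m n → 0 ≤ (L (f * conjP f)).re
  nonzero : ∃ f ∈ bihom 4 4, L f ≠ 0

/-- The forms of bidegree `(m, n)` whose products with all forms of bidegree `(m', n')` are
annihilated by `L`. -/
def annih (L : BiPoly →ₗ[ℂ] ℂ) (m n m' n' : ℕ) : Submodule ℂ BiPoly where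
  carrier := {f | f ∈ bihom m n ∧ ∀ h ∈ bihom m' n', L (f * h) = 0}
  add_mem' := fun ha hb => ⟨add_mem ha.1 hb.1, fun h hh => by
    rw [add_mul, map_add, ha.2 h hh, hb.2 h hh, add_zero]⟩
  zero_mem' := ⟨zero_mem _, fun h _ => by simp⟩
  smul_mem' := fun c f hf => ⟨Submodule.smul_mem _ _ hf.1, fun h hh => by
    rw [smul_mul_assoc, map_smul, hf.2 h hh, smul_zero]⟩

/-- All kernels have a common zero of the form `(e, conj e)`. -/
def HasRealZero (L : BiPoly →ₗ[ℂ] ℂ) : Prop :=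
  ∃ e : Fin 2 → ℂ, e ≠ 0 ∧ ∀ m n, m + n = 4 → ∀ f ∈ annih L m n n m, evalAt e (star e) f = 0

variable {L : BiPoly →ₗ[ℂ] ℂ}

theorem map_C_mul (c : ℂ) (f : BiPoly) : L (C c * f) = c * L f := by
  rw [C_mul', map_smul, smul_eq_mul]

theorem conjP_mem_annih (hL : IsPPTFunctional L) {m n m' n' : ℕ} {f : BiPoly}
    (hf : f ∈ annih L m n m' n') : conjP f ∈ annih L n m n' m' := by
  refine ⟨conjP_mem hf.1, fun h hh => ?_⟩
  have := hL.conj (f * conjP h)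
  rwa [hf.2 _ (conjP_mem hh), map_zero, map_mul, conjP_conjP] at this

theorem mul_mem_annih {m n m' n' a b p q M N : ℕ} {f u : BiPoly} (hf : f ∈ annih L m n m' n')
    (hu : u ∈ bihom a b) (hM : m + a = M := by omega) (hN : n + b = N := by omega)
    (hp : a + p = m' := by omega) (hq : b + q = n' := by omega) : f * u ∈ annih L M N p q :=
  ⟨bihom_mul hf.1 hu hM hN, fun h hh => by
    rw [mul_assoc]; exact hf.2 _ (bihom_mul hu hh hp hq)⟩

/-- The kernel of a positive semidefinite form is its set of isotropic vectors. -/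
theorem mem_annih_of_norm_eq_zero (hL : IsPPTFunctional L) {m n : ℕ} (hmn : m + n = 4)
    {f : BiPoly} (hf : f ∈ bihom m n) (h0 : L (f * conjP f) = 0) : f ∈ annih L m n n m := by
  refine ⟨hf, fun g hg => ?_⟩
  set h := conjP g with hh
  have hhm : h ∈ bihom m n := conjP_mem hg
  set a := L (f * g) with ha
  have hgh : g = conjP h := by simp [hh]
  have hconj : L (h * conjP f) = starRingEnd ℂ a := by
    rw [ha, ← hL.conj, map_mul conjP, hh, mul_comm]
  set b := (L (h * conjP h)).re with hb
  -- Cauchy–Schwarz argument: L(|f + τh|²) ≥ 0 at τ = -r a, where the term L(|f|²) is absent.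
  have key : ∀ r : ℝ, 0 ≤ -2 * r * Complex.normSq a + r ^ 2 * Complex.normSq a * b := by
    intro r
    have h1 := hL.nonneg hmn
      (add_mem hf (C_mul_mem (-(r : ℂ) * a) hhm) : f + C (-(r : ℂ) * a) * h ∈ bihom m n)
    have h2 : ∀ τ : ℂ, L ((f + C τ * h) * conjP (f + C τ * h))
        = L (f * conjP f) + starRingEnd ℂ τ * a + τ * L (h * conjP f)
          + τ * starRingEnd ℂ τ * L (h * conjP h) := by
      intro τ
      rw [ha, ← map_C_mul, ← map_C_mul, ← map_C_mul, ← map_add, ← map_add, ← map_add]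
      congr 1
      rw [map_add conjP, map_mul conjP, conjP_C, hgh, C_mul]
      ring
    rw [h2, h0, hconj] at h1
    have e1 : (starRingEnd ℂ (-(r : ℂ) * a) * a).re = -r * Complex.normSq a := by
      simp [Complex.normSq_apply]; ring
    have e2 : ((-(r : ℂ) * a) * starRingEnd ℂ a).re = -r * Complex.normSq a := by
      simp [Complex.normSq_apply]; ring
    have e3 : ((-(r : ℂ) * a) * starRingEnd ℂ (-(r : ℂ) * a) * L (h * conjP h)).re
        = r ^ 2 * Complex.normSq a * b := by
      rw [Complex.mul_conj, Complex.re_ofReal_mul, ← hb,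
        show Complex.normSq (-(r : ℂ) * a) = r ^ 2 * Complex.normSq a by
          simp [Complex.normSq_apply]; ring]
    simp only [Complex.add_re, Complex.zero_re, e1, e2, e3] at h1
    linarith
  have hb0 : 0 ≤ b := hL.nonneg hmn hhm
  -- The choice 1/(1+b) rather than 1/b also covers b = 0; the bound becomes a negative multiple of
  -- |a|².
  have h3 := key (1 / (1 + b))
  have h4 : -2 * (1 / (1 + b)) * Complex.normSq a + (1 / (1 + b)) ^ 2 * Complex.normSq a * b
      = -(Complex.normSq a * ((2 + b) / (1 + b) ^ 2)) := by
    field_simp; ring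
  rw [h4] at h3
  have h5 : 0 < (2 + b) / (1 + b) ^ 2 := by positivity
  have h6 : Complex.normSq a ≤ 0 := by
    by_contra hc
    push Not at hc
    have := mul_pos hc h5
    linarith
  exact Complex.normSq_eq_zero.mp (le_antisymm h6 (Complex.normSq_nonneg a))

theorem norm_eq_zero_of_mem_annih {m n : ℕ} {f : BiPoly} (hf : f ∈ annih L m n n m) :
    L (f * conjP f) = 0 := hf.2 _ (conjP_mem hf.1)

/-- Conjugation exchanges the kernels of bidegrees (m,n) and (n,m) and conjugates values at (e, ē),
so three of the five bidegrees suffice. -/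
theorem hasRealZero_of (hL : IsPPTFunctional L) {e : Fin 2 → ℂ} (he : e ≠ 0)
    (h4 : ∀ f ∈ annih L 4 0 0 4, evalAt e (star e) f = 0)
    (h3 : ∀ f ∈ annih L 3 1 1 3, evalAt e (star e) f = 0)
    (h2 : ∀ f ∈ annih L 2 2 2 2, evalAt e (star e) f = 0) : HasRealZero L := by
  refine ⟨e, he, fun m n hmn f hf => ?_⟩
  have hconj := conjP_mem_annih hL hf
  have hev : evalAt e (star e) (conjP f) = 0 → evalAt e (star e) f = 0 := fun h => by
    rw [evalAt_conjP, star_star] at h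
    exact (map_eq_zero _).mp h
  have hm : m ≤ 4 := by omega
  obtain rfl : n = 4 - m := by omega
  interval_cases m
  · exact hev (h4 _ hconj)
  · exact hev (h3 _ hconj)
  · exact h2 f hf
  · exact h3 f hf
  · exact h4 f hf

/-- Every monomial of the full bidegree splits into monomials of the two smaller bidegrees. -/
theorem map_eq_zero_of_forall_mul {φ : BiPoly →ₗ[ℂ] ℂ} {a b p q M N : ℕ} (hM : a + p = M)
    (hN : b + q = N) (h : ∀ u ∈ bihom a b, ∀ v ∈ bihom p q, φ (u * v) = 0) {f : BiPoly}
    (hf : f ∈ bihom M N) : φ f = 0 := by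
  subst hM hN
  induction hf using bihom_induction with
  | mon i j hi hj =>
    have h1 := h _ (biMon_mem (m := a) (n := b) (i := min i a) (j := min j b)
      (min_le_right _ _) (min_le_right _ _)) _ (biMon_mem (m := p) (n := q) (i := i - min i a)
      (j := j - min j b) (by omega) (by omega))
    rw [biMon_mul (by omega) (by omega) (by omega) (by omega)] at h1
    rwa [show min i a + (i - min i a) = i by omega, show min j b + (j - min j b) = j by omega]
      at h1
  | add f g _ _ h1 h2 => rw [map_add, h1, h2, add_zero]
  | zero => exact map_zero _
  | smul c f _ h => rw [C_mul', map_smul, h, smul_zero]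

/-- A functional that annihilates all multiples of `x₁` and of `y₁` is a multiple of the
evaluation at `(1, 0)`. -/
theorem eq_evalAt_of_annihilates {φ : BiPoly →ₗ[ℂ] ℂ} {p q : ℕ}
    (hx : ∀ h ∈ bihom p (q + 1), φ (x₁ * h) = 0) (hy : ∀ h ∈ bihom (p + 1) q, φ (y₁ * h) = 0)
    {f : BiPoly} (hf : f ∈ bihom (p + 1) (q + 1)) :
    φ f = evalAt ![1, 0] ![1, 0] f * φ (x₀ ^ (p + 1) * y₀ ^ (q + 1)) := by
  induction hf using bihom_induction with
  | mon i j hi hj =>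
    rcases i with _ | i
    · rcases j with _ | j
      · simp [biMon]
      · have h1 := hy _ (biMon_mem (m := p + 1) (n := q) (i := 0) (j := j) (by omega) (by omega))
        have h2 : biMon (p + 1) (q + 1) 0 (j + 1) = y₁ * biMon (p + 1) q 0 j := by
          simp only [biMon, show q + 1 - (j + 1) = q - j by omega]; ring
        rw [h2, h1]; simp
    · have h1 := hx _ (biMon_mem (m := p) (n := q + 1) (i := i) (j := j) (by omega) (by omega))
      have h2 : biMon (p + 1) (q + 1) (i + 1) j = x₁ * biMon p (q + 1) i j := by
        simp only [biMon, show p + 1 - (i + 1) = p - i by omega]; ring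
      rw [h2, h1]; simp
  | add f g _ _ h1 h2 => rw [map_add, h1, h2, map_add, add_mul]
  | zero => simp
  | smul c f _ h => rw [C_mul', map_smul, h, map_smul]; simp [mul_assoc]

/-- If `x₁ f` lies in a kernel then so does `y₁ f`. -/
theorem y1_mul_annihilated (hL : IsPPTFunctional L) {m n p q : ℕ} {f : BiPoly}
    (hf : f ∈ bihom m n) (hmn : m + n ≤ 3) (hp : m + 1 + p = 4) (hq : n + q + 1 = 4)
    (hx : x₁ * f ∈ annih L (m + 1) n p (q + 1)) :
    ∀ h ∈ bihom (p + 1) q, L (y₁ * f * h) = 0 := by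
  intro h hh
  -- A factor u of degree α in x raises y₁f to total degree 4, where positivity applies. There
  -- |y₁fu|² = |x₁fu|² is x₁f times an admissible test form.
  obtain ⟨α, hα⟩ : ∃ α, m + n + α = 3 := ⟨3 - (m + n), by omega⟩
  refine map_eq_zero_of_forall_mul (φ := L.comp (LinearMap.mulLeft ℂ (y₁ * f)))
    (a := α) (b := 0) (p := n + 1) (q := m + α) (by omega) (by omega) (fun u hu v hv => ?_) hh
  have h1 : y₁ * f * u ∈ bihom (m + α) (n + 1) :=
    bihom_mul (bihom_mul y1_mem hf rfl rfl) hu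
  have h2 : L (y₁ * f * u * conjP (y₁ * f * u)) = 0 := by
    have : y₁ * f * u * conjP (y₁ * f * u) = x₁ * f * (u * conjP (x₁ * f * u)) := by
      simp only [map_mul, conjP_y1, conjP_x1]; ring
    rw [this]
    refine hx.2 _ (bihom_mul (m' := n) (n' := m + 1 + α) hu (conjP_mem ?_))
    exact bihom_mul (bihom_mul x1_mem hf (m' := m) (n' := n) (M := m + 1) (N := n)) hu
  have h3 := mem_annih_of_norm_eq_zero hL (by omega) h1 h2
  simpa [mul_assoc] using h3.2 v hv

/-- The main dichotomy: if `x₁ f` is annihilated then either `f` is, or the functional `L (f ·)`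
is a nonzero multiple of the evaluation at `(1, 0)`, so that `(1, 0)` is a zero of kernels. -/
theorem annih_or_evalAt_eq_zero (hL : IsPPTFunctional L) {m n p q : ℕ} {f : BiPoly}
    (hf : f ∈ bihom m n) (hmn : m + n ≤ 3) (hp : m + 1 + p = 4) (hq : n + q + 1 = 4)
    (hx : x₁ * f ∈ annih L (m + 1) n p (q + 1)) :
    f ∈ annih L m n (p + 1) (q + 1) ∨ (L (f * (x₀ ^ (p + 1) * y₀ ^ (q + 1))) ≠ 0 ∧
      ∀ a b a' b', a + a' = 4 → b + b' = 4 → m ≤ a' → n ≤ b' → ∀ k ∈ annih L a b a' b',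
        evalAt ![1, 0] ![1, 0] k = 0) := by
  have hy := y1_mul_annihilated hL hf hmn hp hq hx
  have hev : ∀ h ∈ bihom (p + 1) (q + 1), L (f * h)
      = evalAt ![1, 0] ![1, 0] h * L (f * (x₀ ^ (p + 1) * y₀ ^ (q + 1))) := by
    intro h hh
    refine eq_evalAt_of_annihilates (φ := L.comp (LinearMap.mulLeft ℂ f)) ?_ ?_ hh
    · intro u hu
      simpa [mul_assoc, mul_left_comm] using hx.2 u hu
    · intro u hu
      simpa [mul_assoc, mul_left_comm] using hy u hu
  by_cases hc : L (f * (x₀ ^ (p + 1) * y₀ ^ (q + 1))) = 0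
  · left
    exact ⟨hf, fun h hh => by rw [hev h hh, hc, mul_zero]⟩
  · refine Or.inr ⟨hc, fun a b a' b' ha hb hma hnb k hk => ?_⟩
    -- The padding by u, possible since m ≤ a' and n ≤ b', makes fu a test form for k; u has value 1
    -- at (1,0).
    set u := x₀ ^ (a' - m) * y₀ ^ (b' - n) with hu
    have hum : u ∈ bihom (a' - m) (b' - n) := x0_pow_mul_y0_pow_mem _ _
    have h1 : L (f * (u * k)) = 0 := by
      have := hk.2 _ (bihom_mul hf hum (M := a') (N := b'))
      rwa [show k * (f * u) = f * (u * k) by ring] at this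
    rw [hev _ (bihom_mul hum hk.1)] at h1
    have h2 := (mul_eq_zero.mp h1).resolve_right hc
    simpa [hu] using h2

theorem star_vec_one_zero : star (![1, 0] : Fin 2 → ℂ) = ![1, 0] := by
  funext i; fin_cases i <;> simp

theorem vec_one_zero_ne_zero : (![1, 0] : Fin 2 → ℂ) ≠ 0 := fun h => by simpa using congrFun h 0

/-! ### Functionals under a change of coordinates -/

section coordinates

variable {A : Matrix (Fin 2) (Fin 2) ℂ}

/-- The functional in the coordinates given by `A`. -/
noncomputable def changeCoord (A : Matrix (Fin 2) (Fin 2) ℂ) (L : BiPoly →ₗ[ℂ] ℂ) :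
    BiPoly →ₗ[ℂ] ℂ :=
  L.comp (subst A⁻¹).toLinearMap

theorem changeCoord_apply (f : BiPoly) : changeCoord A L f = L (subst A⁻¹ f) := rfl

theorem subst_inv_subst (hA : IsUnit A.det) (f : BiPoly) : subst A⁻¹ (subst A f) = f := by
  rw [subst_subst, Matrix.mul_nonsing_inv _ hA, subst_one]

theorem subst_subst_inv (hA : IsUnit A.det) (f : BiPoly) : subst A (subst A⁻¹ f) = f := by
  rw [subst_subst, Matrix.nonsing_inv_mul _ hA, subst_one]

theorem IsPPTFunctional.changeCoord (hL : IsPPTFunctional L) (hA : IsUnit A.det) :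
    IsPPTFunctional (changeCoord A L) where
  conj f := by rw [changeCoord_apply, changeCoord_apply, ← conjP_subst, hL.conj]
  nonneg h hf := by
    rw [changeCoord_apply, map_mul, ← conjP_subst]
    exact hL.nonneg h (subst_mem _ hf)
  nonzero := by
    obtain ⟨f, hf, h⟩ := hL.nonzero
    exact ⟨subst A f, subst_mem _ hf, by rwa [changeCoord_apply, subst_inv_subst hA]⟩

theorem subst_mem_annih (hA : IsUnit A.det) {m n m' n' : ℕ} {f : BiPoly}
    (hf : f ∈ annih L m n m' n') : subst A f ∈ annih (changeCoord A L) m n m' n' :=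
  ⟨subst_mem _ hf.1, fun h hh => by
    rw [changeCoord_apply, map_mul, subst_inv_subst hA]; exact hf.2 _ (subst_mem _ hh)⟩

theorem HasRealZero.of_changeCoord (hA : IsUnit A.det) (h : HasRealZero (changeCoord A L)) :
    HasRealZero L := by
  obtain ⟨e, he, h⟩ := h
  refine ⟨A.mulVec e, fun h0 => he ?_, fun m n hmn f hf => ?_⟩
  · have := congrArg A⁻¹.mulVec h0
    rwa [Matrix.mulVec_mulVec, Matrix.nonsing_inv_mul _ hA, Matrix.one_mulVec,
      Matrix.mulVec_zero] at this
  · rw [← evalAt_subst]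
    exact h m n hmn _ (subst_mem_annih hA hf)

/-- Coordinates in which a form vanishing at `x = e` is divisible by `x₁`. -/
theorem exists_coord_eq_x1_mul {m n : ℕ} {e : Fin 2 → ℂ} (he : e ≠ 0) {k : BiPoly}
    (hk : k ∈ bihom (m + 1) n) (h0 : k ≠ 0) (hv : evalX e k = 0) :
    ∃ A : Matrix (Fin 2) (Fin 2) ℂ, IsUnit A.det ∧ ∃ f ∈ bihom m n, f ≠ 0 ∧
      subst A k = x₁ * f := by
  obtain ⟨A, hA, hAe⟩ := exists_matrix_mulVec_eq he
  obtain ⟨f, hf, hkf⟩ := exists_eq_x1_mul (subst_mem A hk)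
    (by rw [evalX_subst, hAe, hv, map_zero])
  refine ⟨A, hA, f, hf, fun h => h0 (subst_injective A hA ?_), hkf⟩
  rw [hkf, h, mul_zero, map_zero]

end coordinates

/-! ### Nontrivial kernel in bidegree (4,0) -/

/-- Two roots of a quartic in the kernel. -/
theorem annih_or_hasRealZero_of_two_roots (hL : IsPPTFunctional L) {g : BiPoly}
    (hg : g ∈ bihom 2 0) (ha : x₁ * (x₀ * g) ∈ annih L 4 0 0 4) :
    x₀ * g ∈ annih L 3 0 1 4 ∨ HasRealZero L := by
  have hxg : x₀ * g ∈ bihom 3 0 := bihom_mul x0_mem hg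
  refine (annih_or_evalAt_eq_zero hL hxg (by omega) (p := 0) (q := 3) rfl rfl ha).imp id ?_
  rintro ⟨hc, hv⟩
  have hy := y1_mul_annihilated hL hxg (by omega) (p := 0) (q := 3) rfl rfl ha
  have hy0 : y₀ * (x₁ * g) ∈ annih L 3 1 1 3 := by
    have h1 : x₁ * g ∈ bihom 3 0 := bihom_mul x1_mem hg
    have h2 : y₀ * (x₁ * g) ∈ bihom 3 1 := bihom_mul y0_mem h1
    refine mem_annih_of_norm_eq_zero hL rfl h2 ?_
    have h3 : y₀ * (x₁ * g) * conjP (y₀ * (x₁ * g))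
        = x₁ * (x₀ * g) * conjP (x₁ * (x₀ * g)) := by
      simp only [map_mul, conjP_x0, conjP_x1, conjP_y0]
      ring
    rw [h3]
    exact norm_eq_zero_of_mem_annih ha
  have hconj : ∀ f, evalAt ![1, 0] ![1, 0] (conjP f) = 0 →
      evalAt ![1, 0] (star ![1, 0]) f = 0 := fun f h => by
    rw [evalAt_conjP, star_vec_one_zero] at h
    rw [star_vec_one_zero]
    exact (map_eq_zero _).mp h
  refine hasRealZero_of hL vec_one_zero_ne_zero (fun f hf => ?_) (fun f hf => ?_)
    (fun f hf => ?_)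
  · exact hconj f (hv 0 4 4 0 rfl rfl (by omega) (by omega) _ (conjP_mem_annih hL hf))
  · exact hconj f (hv 1 3 3 1 rfl rfl (by omega) (by omega) _ (conjP_mem_annih hL hf))
  -- The degree of x₀g is too high for a test form of bidegree (2,2), so g y₀² is used instead.
  -- Apart from x₀²y₀², the monomials h without x₁ are killed through y₁x₀g, those with x₁ to the
  -- first power through x₁x₀g, those with x₁² through y₀x₁g.
  · have key : ∀ h ∈ bihom 2 2, L (g * y₀ ^ 2 * h)
        = evalAt ![1, 0] ![1, 0] h * L (x₀ * g * (x₀ ^ 1 * y₀ ^ 4)) := by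
      intro h hh
      induction hh using bihom_induction with
      | mon i j hi hj =>
        interval_cases i
        · rcases j with _ | j
          · have h2 : g * y₀ ^ 2 * biMon 2 2 0 0 = x₀ * g * (x₀ ^ 1 * y₀ ^ 4) := by
              simp only [biMon]; ring
            rw [h2]; simp [biMon]
          · have h1 := hy (x₀ * y₀ ^ 2 * (y₀ ^ (1 - j) * y₁ ^ j))
              (bihom_mul (m := 1) (n := 2) (m' := 0) (n' := 1)
                (bihom_mul x0_mem (y0_pow_mem 2))
                (bihom_mul (bihom_pow y0_mem (1 - j) rfl rfl) (bihom_pow y1_mem j rfl rfl)))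
            have h2 : g * y₀ ^ 2 * biMon 2 2 0 (j + 1)
                = y₁ * (x₀ * g) * (x₀ * y₀ ^ 2 * (y₀ ^ (1 - j) * y₁ ^ j)) := by
              simp only [biMon, show 2 - (j + 1) = 1 - j by omega]; ring
            rw [h2, h1]; simp [biMon]
        · have h1 := ha.2 (y₀ ^ 2 * (y₀ ^ (2 - j) * y₁ ^ j))
              (bihom_mul (m := 0) (n := 2) (m' := 0) (n' := 2) (y0_pow_mem 2)
                (bihom_mul (bihom_pow y0_mem (2 - j) rfl rfl) (bihom_pow y1_mem j rfl rfl)))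
          have h2 : g * y₀ ^ 2 * biMon 2 2 1 j
              = x₁ * (x₀ * g) * (y₀ ^ 2 * (y₀ ^ (2 - j) * y₁ ^ j)) := by
            simp only [biMon]; ring
          rw [h2, h1]; simp [biMon]
        · have h1 := hy0.2 (x₁ * y₀ * (y₀ ^ (2 - j) * y₁ ^ j))
              (bihom_mul (m := 1) (n := 1) (m' := 0) (n' := 2) (bihom_mul x1_mem y0_mem)
                (bihom_mul (bihom_pow y0_mem (2 - j) rfl rfl) (bihom_pow y1_mem j rfl rfl)))
          have h2 : g * y₀ ^ 2 * biMon 2 2 2 j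
              = y₀ * (x₁ * g) * (x₁ * y₀ * (y₀ ^ (2 - j) * y₁ ^ j)) := by
            simp only [biMon]; ring
          rw [h2, h1]; simp [biMon]
      | add f g _ _ h1 h2 => rw [mul_add, map_add, h1, h2, map_add, add_mul]
      | zero => simp
      | smul c f _ h => rw [mul_left_comm, map_C_mul, h, map_mul (evalAt _ _), evalAt_C]; ring
    have h1 := hf.2 (g * y₀ ^ 2) (bihom_mul hg (y0_pow_mem 2))
    rw [mul_comm, key f hf.1] at h1
    rw [star_vec_one_zero]
    exact (mul_eq_zero.mp h1).resolve_right hc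

theorem evalAt_one_zero_of_conjP {f : BiPoly} (h : evalAt ![1, 0] ![1, 0] (conjP f) = 0) :
    evalAt ![1, 0] (star ![1, 0]) f = 0 := by
  rw [evalAt_conjP, star_vec_one_zero] at h
  rw [star_vec_one_zero]
  exact (map_eq_zero _).mp h

/-- Collects the output of the dichotomy. Bidegree (3,1) is within reach of f only for m ≤ 1; for m
= 2 its conjugate (1,3) is used. Bidegree (4,0) and its conjugate are both out of reach when m and n
are positive, hence the separate hypothesis `h4`. -/
theorem hasRealZero_of_evalAt_one_zero (hL : IsPPTFunctional L) {m n : ℕ} (hm : m ≤ 2)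
    (hn : n ≤ 2) (hmn : m + n ≤ 3)
    (hv : ∀ a b a' b', a + a' = 4 → b + b' = 4 → m ≤ a' → n ≤ b' → ∀ k ∈ annih L a b a' b',
      evalAt ![1, 0] ![1, 0] k = 0)
    (h4 : ∀ f ∈ annih L 4 0 0 4, evalAt ![1, 0] (star ![1, 0]) f = 0) : HasRealZero L := by
  refine hasRealZero_of hL vec_one_zero_ne_zero h4 (fun f hf => ?_) (fun f hf => ?_)
  · by_cases h1 : m ≤ 1
    · rw [star_vec_one_zero]
      exact hv 3 1 1 3 rfl rfl h1 (by omega) f hf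
    · exact evalAt_one_zero_of_conjP
        (hv 1 3 3 1 rfl rfl (by omega) (by omega) _ (conjP_mem_annih hL hf))
  · rw [star_vec_one_zero]
    exact hv 2 2 2 2 rfl rfl hm hn f hf

theorem exists_eq_C_of_mem {f : BiPoly} (hf : f ∈ bihom 0 0) : ∃ c, f = C c := by
  obtain ⟨c, rfl⟩ := exists_eq_polyOf hf
  exact ⟨c (0, 0), by simp [polyOf, biMon, Fintype.sum_prod_type]⟩

/-- A nonzero form `a(x)` in the kernel of `ρ` yields a common zero of all kernels. -/
theorem hasRealZero_of_binary_form (k : ℕ) : ∀ (l : ℕ), k + l = 3 → ∀ {L : BiPoly →ₗ[ℂ] ℂ},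
    IsPPTFunctional L → ∀ {a : BiPoly}, a ≠ 0 → a ∈ annih L (k + 1) 0 l 4 → HasRealZero L := by
  induction k with
  | zero =>
    intro l hl L hL a ha0 ha
    obtain ⟨e, he, hz⟩ := exists_zero_of_mem (by omega) ha.1
    obtain ⟨A, hA, f, hf, hf0, haf⟩ := exists_coord_eq_x1_mul he ha.1 ha0
      (by rw [evalX_of_mem ha.1 e 0, hz, C_0])
    have hL' := hL.changeCoord hA
    have ha' := subst_mem_annih hA ha
    rw [haf] at ha'
    refine HasRealZero.of_changeCoord hA ?_
    rcases annih_or_evalAt_eq_zero hL' hf (by omega) (p := l) (q := 3) (by omega) rfl ha' with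
      h | ⟨-, h⟩
    -- An annihilated nonzero constant would make L vanish on all forms of bidegree (4,4).
    · obtain ⟨c, rfl⟩ := exists_eq_C_of_mem hf
      obtain ⟨g, hg, hg0⟩ := hL'.nonzero
      obtain rfl : l = 3 := by omega
      have h1 := h.2 g hg
      rw [map_C_mul] at h1
      rcases mul_eq_zero.mp h1 with h2 | h2
      · exact absurd (by rw [h2, C_0]) hf0
      · exact absurd h2 hg0
    · exact hasRealZero_of_evalAt_one_zero hL' (by omega) (by omega) (by omega) h fun f hf =>
        evalAt_one_zero_of_conjP (h 0 4 4 0 rfl rfl (by omega) (by omega) _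
          (conjP_mem_annih hL' hf))
  | succ k ih =>
    intro l hl L hL a ha0 ha
    obtain ⟨e, he, hz⟩ := exists_zero_of_mem (by omega) ha.1
    obtain ⟨A, hA, f, hf, hf0, haf⟩ := exists_coord_eq_x1_mul he ha.1 ha0
      (by rw [evalX_of_mem ha.1 e 0, hz, C_0])
    have hL' := hL.changeCoord hA
    have ha' := subst_mem_annih hA ha
    rw [haf] at ha'
    refine HasRealZero.of_changeCoord hA ?_
    generalize changeCoord A L = L' at hL' ha'
    -- For k ≤ 1 the cofactor has degree at most 2 and pads to a test form for bidegree (2,2). The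
    -- cubic cofactor of a quartic does not, and needs an argument on its roots.
    by_cases hk : k ≤ 1
    · rcases annih_or_evalAt_eq_zero hL' hf (by omega) (p := l) (q := 3) (by omega) rfl ha' with
        h | ⟨-, h⟩
      · exact ih (l + 1) (by omega) hL' hf0 h
      · exact hasRealZero_of_evalAt_one_zero hL' (by omega) (by omega) (by omega) h fun f hf =>
          evalAt_one_zero_of_conjP (h 0 4 4 0 rfl rfl (by omega) (by omega) _
            (conjP_mem_annih hL' hf))
    · obtain rfl : k = 2 := by omega
      obtain rfl : l = 0 := by omega
      by_cases hev : evalX ![1, 0] f = 0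
      -- Double root at (1,0): |x₀x₁g|² is a multiple of the annihilated y₁x₁g, so x₀(x₁g) lies in
      -- the kernel along with x₁(x₁g). Together they annihilate the cubic x₁g.
      · obtain ⟨g, hg, rfl⟩ := exists_eq_x1_mul hf hev
        have hy := y1_mul_annihilated hL' hf (by omega) (p := 0) (q := 3) rfl rfl ha'
        have h1 : x₀ * (x₁ * g) ∈ annih L' 4 0 0 4 := by
          refine mem_annih_of_norm_eq_zero hL' rfl (bihom_mul x0_mem hf) ?_
          have h2 : x₀ * y₀ ∈ bihom 1 1 := bihom_mul x0_mem y0_mem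
          have h3 := hy (x₀ * y₀ * conjP g) (bihom_mul h2 (conjP_mem hg))
          have h4 : y₁ * (x₁ * g) * (x₀ * y₀ * conjP g)
              = x₀ * (x₁ * g) * conjP (x₀ * (x₁ * g)) := by
            simp only [map_mul, conjP_x0, conjP_x1]; ring
          rwa [h4] at h3
        refine ih 1 (by omega) hL' hf0 ⟨hf, fun h hh => ?_⟩
        refine map_eq_zero_of_forall_mul (φ := L'.comp (LinearMap.mulLeft ℂ (x₁ * g)))
          (a := 1) (b := 0) (p := 0) (q := 4) rfl rfl (fun u hu v hv => ?_) hh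
        obtain ⟨c, rfl⟩ := exists_eq_polyOf hu
        have h5 : L' (x₁ * g * (polyOf 1 0 c * v))
            = c (0, 0) * L' (x₀ * (x₁ * g) * v) + c (1, 0) * L' (x₁ * (x₁ * g) * v) := by
          rw [← map_C_mul, ← map_C_mul, ← map_add]
          have : x₁ * g * (polyOf 1 0 c * v)
              = C (c (0, 0)) * (x₀ * (x₁ * g) * v) + C (c (1, 0)) * (x₁ * (x₁ * g) * v) := by
            simp [polyOf, biMon, Fintype.sum_prod_type]; ring
          rw [this]
        rw [LinearMap.comp_apply, LinearMap.mulLeft_apply, h5, h1.2 v hv, ha'.2 v hv]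
        simp
      -- The cubic has a root s other than (1,0). The matrix B fixes (1,0) and sends (0,1) to s, so
      -- the quartic becomes a multiple of x₀x₁.
      · obtain ⟨s, hs, hz2⟩ := exists_zero_of_mem (by omega) hf
        have hs1 : s 1 ≠ 0 := by
          intro h1
          have hs0 : s 0 ≠ 0 := fun h0 => hs (by funext i; fin_cases i <;> simp [h0, h1])
          obtain ⟨g, hg, hfg⟩ := exists_eq_x1_mul_add hf
          have h2 := hz2 0
          rw [hfg, evalX_of_mem hf ![1, 0] 0] at h2
          simp [h1, hs0] at h2
          exact hev (by rw [evalX_of_mem hf ![1, 0] 0, h2, C_0])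
        set B : Matrix (Fin 2) (Fin 2) ℂ := !![1, s 0; 0, s 1] with hB
        have hBu : IsUnit B.det := by simp [hB, Matrix.det_fin_two, hs1]
        have hBs : B.mulVec ![0, 1] = s := by
          funext i; fin_cases i <;> simp [hB]
        have hB1 : subst B x₁ = C (s 1) * x₁ := by simp [hB]
        obtain ⟨g, hg, hfg⟩ := exists_eq_x0_mul (subst_mem B hf) (by
          rw [evalX_subst, hBs, evalX_of_mem hf s 0, hz2, C_0, map_zero])
        have ha2 := subst_mem_annih hBu ha'
        rw [map_mul, hB1, hfg, mul_assoc, C_mul'] at ha2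
        replace ha2 := Submodule.smul_mem _ (s 1)⁻¹ ha2
        rw [inv_smul_smul₀ hs1] at ha2
        have hL2 := hL'.changeCoord hBu
        refine HasRealZero.of_changeCoord hBu ?_
        rcases annih_or_hasRealZero_of_two_roots hL2 hg ha2 with h | h
        · refine ih 1 (by omega) hL2 ?_ h
          rw [← hfg]
          exact fun h0 => hf0 (subst_injective B hBu (by rw [h0, map_zero]))
        · exact h

theorem hasRealZero_of_quartic (hL : IsPPTFunctional L) {a : BiPoly} (ha0 : a ≠ 0)
    (ha : a ∈ annih L 4 0 0 4) : HasRealZero L :=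
  hasRealZero_of_binary_form 3 0 rfl hL ha0 ha

/-! ### Annihilated forms of bidegrees (1,1) and (2,1) -/

/-- If `x₁ f` lies in a kernel, then there is a common zero of all kernels unless `f` is
annihilated. -/
theorem annih_or_hasRealZero (hL : IsPPTFunctional L) {m n p q : ℕ} {f : BiPoly}
    (hf : f ∈ bihom m n) (hm : m ≤ 2) (hn : n ≤ 2) (hmn : m + n ≤ 3) (hp : m + 1 + p = 4)
    (hq : n + q + 1 = 4) (hx : x₁ * f ∈ annih L (m + 1) n p (q + 1)) :
    f ∈ annih L m n (p + 1) (q + 1) ∨ HasRealZero L := by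
  refine (annih_or_evalAt_eq_zero hL hf hmn hp hq hx).imp id fun ⟨_, hv⟩ => ?_
  by_cases h4 : ∃ a ∈ annih L 4 0 0 4, a ≠ 0
  · obtain ⟨a, ha, ha0⟩ := h4
    exact hasRealZero_of_quartic hL ha0 ha
  · push Not at h4
    exact hasRealZero_of_evalAt_one_zero hL hm hn hmn hv fun f hf => by
      rw [h4 f hf, map_zero]

theorem exists_eq_y0_mul_add {m n : ℕ} {f : BiPoly} (hf : f ∈ bihom m (n + 1)) :
    ∃ a ∈ bihom m n, ∃ b ∈ bihom m n, f = y₀ * a + y₁ * b := by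
  induction hf using bihom_induction with
  | mon i j hi hj =>
    rcases Nat.lt_or_ge n j with h | h
    · obtain rfl : j = n + 1 := by omega
      refine ⟨0, zero_mem _, biMon m n i n, biMon_mem hi le_rfl, ?_⟩
      simp only [biMon, Nat.sub_self]; ring
    · refine ⟨biMon m n i j, biMon_mem hi h, 0, zero_mem _, ?_⟩
      simp only [biMon, show n + 1 - j = n - j + 1 by omega]; ring
  | add f g _ _ h1 h2 =>
    obtain ⟨a, ha, b, hb, rfl⟩ := h1
    obtain ⟨a', ha', b', hb', rfl⟩ := h2
    exact ⟨a + a', add_mem ha ha', b + b', add_mem hb hb', by ring⟩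
  | zero => exact ⟨0, zero_mem _, 0, zero_mem _, by simp⟩
  | smul c f _ h =>
    obtain ⟨a, ha, b, hb, rfl⟩ := h
    exact ⟨C c * a, C_mul_mem c ha, C c * b, C_mul_mem c hb, by ring⟩

/-- A functional that annihilates the multiples of `β x₁ y₀ + conj β x₀ y₁ + b x₁ y₁` identifies
`(y₀, y₁)` with `(conj β x₀ + b x₁, -β x₁)`; this maps kernels to kernels. -/
theorem exists_annih_of_circle {β b : ℂ} {m n : ℕ} (hmn : m + n = 3)
    (hc : C β * x₁ * y₀ + C (starRingEnd ℂ β) * x₀ * y₁ + C b * x₁ * y₁ ∈ annih L 1 1 3 3)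
    {h : BiPoly} (hh : h ∈ annih L m (n + 1) (n + 1) m) :
    ∃ h' ∈ annih L (m + 1) n n (m + 1),
      evalAt ![1, 0] ![1, 0] h' = starRingEnd ℂ β * evalAt ![1, 0] ![1, 0] h := by
  set c := C β * x₁ * y₀ + C (starRingEnd ℂ β) * x₀ * y₁ + C b * x₁ * y₁ with hcdef
  set ℓ := C (starRingEnd ℂ β) * x₀ + C b * x₁ with hℓ
  have hℓm : ℓ ∈ bihom 1 0 := add_mem (C_mul_mem _ x0_mem) (C_mul_mem _ x1_mem)
  have hxm : C β * x₁ ∈ bihom 1 0 := C_mul_mem _ x1_mem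
  obtain ⟨u, hu, v, hv, huv⟩ := exists_eq_y0_mul_add hh.1
  have hmem : ℓ * u - C β * x₁ * v ∈ bihom (m + 1) n :=
    sub_mem (bihom_mul hℓm hu) (bihom_mul hxm hv)
  refine ⟨ℓ * u - C β * x₁ * v, ⟨hmem, fun w hw => ?_⟩, by simp [huv, hℓ]⟩
  obtain ⟨w0, hw0, w1, hw1, rfl⟩ := exists_eq_y0_mul_add hw
  -- With h' = ℓu - βx₁v, the identity says y₀h' ≡ ℓh and y₁h' ≡ -βx₁h modulo c.
  have e : (ℓ * u - C β * x₁ * v) * (y₀ * w0 + y₁ * w1)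
      = h * (ℓ * w0) - c * (v * w0) - h * (C β * x₁ * w1) + c * (u * w1) := by
    rw [huv, hcdef, hℓ]; ring
  rw [e, map_add, map_sub, map_sub, hh.2 _ (bihom_mul hℓm hw0), hh.2 _ (bihom_mul hxm hw1),
    hc.2 _ (bihom_mul hv hw0), hc.2 _ (bihom_mul hu hw1)]
  simp

/-- Nonzero elements of `annih L 1 1 3 3` can be taken real. -/
theorem exists_real_of_mem_annih (hL : IsPPTFunctional L) {n n' : ℕ} {g : BiPoly} (hg0 : g ≠ 0)
    (hg : g ∈ annih L n n n' n') : ∃ c ∈ annih L n n n' n', c ≠ 0 ∧ conjP c = c := by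
  have hg' := conjP_mem_annih hL hg
  by_cases h : g + conjP g = 0
  · refine ⟨C Complex.I * (g - conjP g), ?_, fun h0 => hg0 ?_, ?_⟩
    · rw [C_mul']; exact Submodule.smul_mem _ _ (sub_mem hg hg')
    · have h1 := (mul_eq_zero.mp h0).resolve_left (by simp)
      have h2 : (2 : BiPoly) * g = 0 := by linear_combination h + h1
      exact (mul_eq_zero.mp h2).resolve_left two_ne_zero
    · simp only [map_mul, conjP_C, Complex.conj_I, map_sub, conjP_conjP, C_neg]; ring
  · exact ⟨g + conjP g, add_mem hg hg', h, by rw [map_add, conjP_conjP, add_comm]⟩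

/-- The coefficients of a real form of bidegree `(1, 1)`. -/
theorem exists_coeffs_of_real {c : BiPoly} (hc : c ∈ bihom 1 1) (hr : conjP c = c) :
    ∃ (a b : ℝ) (β : ℂ), c = C (a : ℂ) * x₀ * y₀ + C β * x₁ * y₀ + C (starRingEnd ℂ β) * x₀ * y₁
      + C (b : ℂ) * x₁ * y₁ := by
  obtain ⟨γ, rfl⟩ := exists_eq_polyOf hc
  rw [conjP_polyOf] at hr
  have h := polyOf_injective _ _ hr
  have h00 : starRingEnd ℂ (γ (0, 0)) = γ (0, 0) := congrFun h (0, 0)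
  have h11 : starRingEnd ℂ (γ (1, 1)) = γ (1, 1) := congrFun h (1, 1)
  have h01 : starRingEnd ℂ (γ (1, 0)) = γ (0, 1) := congrFun h (0, 1)
  refine ⟨(γ (0, 0)).re, (γ (1, 1)).re, γ (1, 0), ?_⟩
  rw [Complex.conj_eq_iff_re.mp h00, Complex.conj_eq_iff_re.mp h11, h01]
  simp [polyOf, biMon, Fintype.sum_prod_type]
  ring

theorem x1_pow_mul_annih (hL : IsPPTFunctional L) (h : L (x₁ ^ 4 * y₁ ^ 4) = 0) :
    HasRealZero L := by
  refine hasRealZero_of_quartic hL (a := x₁ ^ 4) (pow_ne_zero _ (X_ne_zero _))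
    (mem_annih_of_norm_eq_zero hL rfl (x1_pow_mem 4) ?_)
  simpa using h

/-- A real form of bidegree `(1, 1)` in the annihilator has an isotropic vector, unless the
kernel of `ρ` is nontrivial. -/
theorem exists_isotropic_or_hasRealZero (hL : IsPPTFunctional L) {c : BiPoly}
    (hc : c ∈ annih L 1 1 3 3) (hr : conjP c = c) :
    (∃ e : Fin 2 → ℂ, e ≠ 0 ∧ evalAt e (star e) c = 0) ∨ HasRealZero L := by
  obtain ⟨a, b, β, rfl⟩ := exists_coeffs_of_real hc.1 hr
  by_cases ha : a = 0
  · exact Or.inl ⟨![1, 0], vec_one_zero_ne_zero, by simp [ha]⟩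
  rcases le_or_gt (a * b - Complex.normSq β) 0 with hD | hD
  · left
    have ha' : (a : ℂ) ≠ 0 := by exact_mod_cast ha
    -- Completing the square, a·c = |a x₀ + β x₁|² + (ab - |β|²)|x₁|²; the witness solves a x₀ + β
    -- x₁ = s x₁ with x₁ = 1 and s² = |β|² - ab.
    set s : ℝ := Real.sqrt (Complex.normSq β - a * b) with hs
    have hss : (s : ℂ) * s = β * starRingEnd ℂ β - a * b := by
      rw [Complex.mul_conj, ← Complex.ofReal_mul, Real.mul_self_sqrt (by linarith)]
      push_cast; ring
    refine ⟨![(s - β) / a, 1], fun h => by simpa using congrFun h 1, ?_⟩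
    simp
    field_simp
    linear_combination hss
  · right
    set ℓ := C (a : ℂ) * x₀ + C β * x₁ with hℓ
    have hℓm : ℓ ∈ bihom 1 0 := add_mem (C_mul_mem _ x0_mem) (C_mul_mem _ x1_mem)
    -- The same square times |x₁³|² now has two nonnegative terms with zero sum, which forces
    -- L(|x₁⁴|²) = 0.
    have h1 := hc.2 (C (a : ℂ) * (x₁ ^ 3 * y₁ ^ 3))
      (C_mul_mem _ (bihom_mul (x1_pow_mem 3) (y1_pow_mem 3)))
    have h2 : (C (a : ℂ) * x₀ * y₀ + C β * x₁ * y₀ + C (starRingEnd ℂ β) * x₀ * y₁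
        + C (b : ℂ) * x₁ * y₁) * (C (a : ℂ) * (x₁ ^ 3 * y₁ ^ 3))
        = (ℓ * x₁ ^ 3) * conjP (ℓ * x₁ ^ 3)
          + C ((a * b - Complex.normSq β : ℝ) : ℂ) * (x₁ ^ 4 * conjP (x₁ ^ 4)) := by
      have h3 : ((a * b - Complex.normSq β : ℝ) : ℂ) = a * b - β * starRingEnd ℂ β := by
        rw [Complex.mul_conj]; push_cast; ring
      rw [h3]
      simp [hℓ]
      ring
    rw [h2, map_add, map_C_mul] at h1
    have h4 := hL.nonneg rfl (bihom_mul hℓm (x1_pow_mem 3) : ℓ * x₁ ^ 3 ∈ bihom 4 0)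
    have h5 := hL.nonneg rfl (x1_pow_mem 4)
    have h6 := congrArg Complex.re h1
    rw [Complex.add_re, Complex.re_ofReal_mul, Complex.zero_re] at h6
    have h7 : (L (x₁ ^ 4 * conjP (x₁ ^ 4))).re = 0 := by
      nlinarith
    have h8 : (L (x₁ ^ 4 * conjP (x₁ ^ 4))).im = 0 := by
      have h9 := hL.conj (x₁ ^ 4 * conjP (x₁ ^ 4))
      rw [map_mul conjP, conjP_conjP, mul_comm] at h9
      exact Complex.conj_eq_iff_im.mp h9.symm
    refine x1_pow_mul_annih hL ?_
    have h10 : L (x₁ ^ 4 * conjP (x₁ ^ 4)) = 0 := Complex.ext h7 h8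
    simpa using h10

/-- An isotropic vector of the Hermitian form is moved to (1,0). If the coefficient β of x₁y₀ is
nonzero, `exists_annih_of_circle` carries kernel forms from bidegree (2,2) to (3,1) and from (3,1)
to (4,0), scaling values at (1,0) by the conjugate of β; a trivial (4,0) kernel then makes all
values zero. If β = 0, only x₁y₁ remains and x₁⁴ is in the kernel. -/
theorem hasRealZero_of_annih_one_one (hL : IsPPTFunctional L) {g : BiPoly} (hg0 : g ≠ 0)
    (hg : g ∈ annih L 1 1 3 3) : HasRealZero L := by
  obtain ⟨c, hc, hc0, hr⟩ := exists_real_of_mem_annih hL hg0 hg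
  rcases exists_isotropic_or_hasRealZero hL hc hr with ⟨e, he, hz⟩ | h
  swap
  · exact h
  obtain ⟨A, hA, hAe⟩ := exists_matrix_mulVec_eq he
  refine HasRealZero.of_changeCoord hA ?_
  have hL' := hL.changeCoord hA
  have hc' := subst_mem_annih hA hc
  have hr' : conjP (subst A c) = subst A c := by rw [conjP_subst, hr]
  have hc0' : subst A c ≠ 0 := fun h => hc0 (subst_injective A hA (by rw [h, map_zero]))
  have hz' : evalAt ![1, 0] ![1, 0] (subst A c) = 0 := by
    rw [← hAe, ← evalAt_subst, star_vec_one_zero] at hz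
    exact hz
  generalize subst A c = c' at hc' hr' hc0' hz'
  generalize changeCoord A L = L' at hL' hc'
  obtain ⟨a, b, β, hcc⟩ := exists_coeffs_of_real hc'.1 hr'
  have ha : (a : ℂ) = 0 := by simpa [hcc] using hz'
  rw [ha, C_0, zero_mul, zero_mul, zero_add] at hcc
  rw [hcc] at hc'
  by_cases hβ : β = 0
  · have hb : (b : ℂ) ≠ 0 := by
      intro hb; apply hc0'; rw [hcc, hβ, hb]; simp
    refine x1_pow_mul_annih hL' ?_
    have h1 := hc'.2 (x₁ ^ 3 * y₁ ^ 3) (bihom_mul (x1_pow_mem 3) (y1_pow_mem 3))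
    have h2 : (C β * x₁ * y₀ + C (starRingEnd ℂ β) * x₀ * y₁ + C (b : ℂ) * x₁ * y₁)
        * (x₁ ^ 3 * y₁ ^ 3) = C (b : ℂ) * (x₁ ^ 4 * y₁ ^ 4) := by
      rw [hβ]; simp; ring
    rw [h2, map_C_mul] at h1
    exact (mul_eq_zero.mp h1).resolve_left hb
  · by_cases h4 : ∃ a ∈ annih L' 4 0 0 4, a ≠ 0
    · obtain ⟨a, ha, ha0⟩ := h4
      exact hasRealZero_of_quartic hL' ha0 ha
    push Not at h4
    have hβ' : starRingEnd ℂ β ≠ 0 := by simpa using hβ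
    have h3 : ∀ f ∈ annih L' 3 1 1 3, evalAt ![1, 0] ![1, 0] f = 0 := by
      intro f hf
      obtain ⟨f', hf', hev⟩ := exists_annih_of_circle rfl hc' hf
      rw [h4 f' hf', map_zero] at hev
      exact (mul_eq_zero.mp hev.symm).resolve_left hβ'
    refine hasRealZero_of hL' vec_one_zero_ne_zero (fun f hf => by rw [h4 f hf, map_zero])
      (by rw [star_vec_one_zero]; exact h3) fun f hf => ?_
    obtain ⟨f', hf', hev⟩ := exists_annih_of_circle rfl hc' hf
    rw [h3 f' hf'] at hev
    rw [star_vec_one_zero]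
    exact (mul_eq_zero.mp hev.symm).resolve_left hβ'

/-- A nontrivial combination of independent forms in the annihilator vanishes at some `x = e`. -/
theorem exists_mem_annih_evalX_eq_zero {m n p q : ℕ} (hm : m ≠ 0) {k : Fin (n + 1) → BiPoly}
    (hk : ∀ a, k a ∈ annih L m n p q) (hi : LinearIndependent ℂ k) :
    ∃ e : Fin 2 → ℂ, e ≠ 0 ∧ ∃ f ∈ annih L m n p q, f ≠ 0 ∧ evalX e f = 0 := by
  obtain ⟨e, he, c, hc, h⟩ := exists_dependent_evalX (m := fun _ => m) (by simp [hm])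
    fun a => (hk a).1
  refine ⟨e, he, ∑ a, c a • k a, sum_mem fun a _ => Submodule.smul_mem _ _ (hk a),
    fun h0 => hc ?_, ?_⟩
  · funext a; exact Fintype.linearIndependent_iff.mp hi c h0 a
  · simpa [C_mul'] using h

/-- A nonzero form `f` of bidegree `(2, 1)` that vanishes at some `x = e`. -/
theorem hasRealZero_of_annih_two_one_evalX (hL : IsPPTFunctional L) {e : Fin 2 → ℂ} (he : e ≠ 0)
    {f : BiPoly} (hf0 : f ≠ 0) (hf : f ∈ annih L 2 1 2 3) (hv : evalX e f = 0) :
    HasRealZero L := by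
  obtain ⟨A, hA, g, hg, hg0, hfg⟩ := exists_coord_eq_x1_mul he hf.1 hf0 hv
  refine HasRealZero.of_changeCoord hA ?_
  have hL' := hL.changeCoord hA
  have hf' := subst_mem_annih hA hf
  rw [hfg] at hf'
  rcases annih_or_hasRealZero hL' hg (by omega) (by omega) (by omega) (p := 2) (q := 2) rfl rfl
    hf' with h | h
  · exact hasRealZero_of_annih_one_one hL' hg0 h
  · exact h

theorem exists_linear_form_eq_one {e : Fin 2 → ℂ} (he : e ≠ 0) :
    ∃ ℓ ∈ bihom 1 0, evalX e ℓ = 1 := by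
  by_cases h : e 0 = 0
  · have h1 : e 1 ≠ 0 := fun h1 => he (by funext i; fin_cases i <;> simp [h, h1])
    refine ⟨C (e 1)⁻¹ * x₁, C_mul_mem _ x1_mem, ?_⟩
    rw [map_mul, evalX_C, evalX_x1, ← C_mul, inv_mul_cancel₀ h1, C_1]
  · refine ⟨C (e 0)⁻¹ * x₀, C_mul_mem _ x0_mem, ?_⟩
    rw [map_mul, evalX_C, evalX_x0, ← C_mul, inv_mul_cancel₀ h, C_1]

/-- A linear form other than `0` that divides `ℓ' f` divides `f` when `ℓ'` depends on `y` only. -/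
theorem exists_evalX_eq_zero_of_mul_eq {ℓ ℓ' f g : BiPoly} (hℓ : ℓ ∈ bihom 1 0)
    (hℓ' : ℓ' ∈ bihom 0 1) (hℓ0 : ℓ' ≠ 0) (h : ℓ' * f = ℓ * g) :
    ∃ e : Fin 2 → ℂ, e ≠ 0 ∧ evalX e f = 0 := by
  obtain ⟨e, he, hz⟩ := exists_zero_of_mem one_ne_zero hℓ
  refine ⟨e, he, ?_⟩
  have h1 := congrArg (evalX e) h
  rw [map_mul, map_mul, evalX_of_mem hℓ e 0, hz, C_0, zero_mul] at h1
  have h2 : evalX e ℓ' = ℓ' := by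
    obtain ⟨c, rfl⟩ := exists_eq_polyOf hℓ'
    simp [polyOf, biMon, Fintype.sum_prod_type]
  rw [h2] at h1
  exact (mul_eq_zero.mp h1).resolve_left hℓ0

/-- The aim is an annihilated form of bidegree (2,1) vanishing at some x = e. A combination k of f
y₀, f y₁ and f̄ vanishes at some x, so it has a linear factor with cofactor g, and the dichotomy
makes g annihilated. If ḡ and f are independent, a combination of them serves. If they are
proportional, k = μf̄ with μ linear in x, whence ℓ'f is f̄ times a linear form in x; as ℓ' involves
only y, f itself vanishes at the zero of that form. -/
theorem hasRealZero_of_annih_two_one (hL : IsPPTFunctional L) {f : BiPoly} (hf0 : f ≠ 0)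
    (hf : f ∈ annih L 2 1 2 3) : HasRealZero L := by
  have hf' : conjP f ∈ annih L 1 2 3 2 := conjP_mem_annih hL hf
  have hf0' : conjP f ≠ 0 := fun h => hf0 (by rw [← conjP_conjP f, h, map_zero])
  obtain ⟨e, he, c, hc, hdep⟩ := exists_dependent_evalX (n := 2) (m := ![2, 2, 1])
    (by simp [Fin.sum_univ_three]) (k := ![f * y₀, f * y₁, conjP f]) (by
      intro a; fin_cases a
      · exact (bihom_mul hf.1 y0_mem : f * y₀ ∈ bihom 2 2)
      · exact (bihom_mul hf.1 y1_mem : f * y₁ ∈ bihom 2 2)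
      · exact hf'.1)
  -- The factor ℓ lifts f̄ to bidegree (2,2) without changing its restriction to x = e.
  obtain ⟨ℓ, hℓ, hℓ1⟩ := exists_linear_form_eq_one he
  set ℓ' := C (c 0) * y₀ + C (c 1) * y₁ with hℓ'
  have hℓ'm : ℓ' ∈ bihom 0 1 := add_mem (C_mul_mem _ y0_mem) (C_mul_mem _ y1_mem)
  set k := f * ℓ' + conjP f * (C (c 2) * ℓ) with hk
  have hkm : k ∈ annih L 2 2 2 2 :=
    add_mem (mul_mem_annih hf hℓ'm) (mul_mem_annih hf' (C_mul_mem _ hℓ))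
  have hkv : evalX e k = 0 := by
    rw [← hdep, hk, hℓ', Fin.sum_univ_three]
    simp [hℓ1]
    ring
  have hcases : ∀ μ : BiPoly, μ ∈ bihom 1 0 → evalX e μ = 0 → k = μ * conjP f →
      HasRealZero L := by
    intro μ hμ hμe hkμ
    by_cases h0 : ℓ' = 0
    · exfalso
      have h1 : C (c 2) * ℓ = μ := by
        rw [hk, h0, mul_zero, zero_add, mul_comm] at hkμ
        exact mul_right_cancel₀ hf0' hkμ
      have h2 : c 2 = 0 := by
        rw [← h1, map_mul, hℓ1, evalX_C, mul_one] at hμe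
        exact C_eq_zero.mp hμe
      have h3 : c 0 = 0 := by simpa [hℓ'] using congrArg (evalAt 0 ![1, 0]) h0
      have h4 : c 1 = 0 := by simpa [hℓ'] using congrArg (evalAt 0 ![0, 1]) h0
      exact hc (by funext i; fin_cases i <;> simp [h2, h3, h4])
    · have h1 : ℓ' * f = (μ - C (c 2) * ℓ) * conjP f := by
        rw [hk] at hkμ; linear_combination hkμ
      obtain ⟨e', he', hz⟩ := exists_evalX_eq_zero_of_mul_eq
        (sub_mem hμ (C_mul_mem _ hℓ)) hℓ'm h0 h1
      exact hasRealZero_of_annih_two_one_evalX hL he' hf0 hf hz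
  obtain ⟨A, hA, hAe⟩ := exists_matrix_mulVec_eq he
  obtain ⟨g, hg, hkg⟩ := exists_eq_x1_mul (subst_mem A hkm.1)
    (by rw [evalX_subst, hAe, hkv, map_zero])
  have hL' := hL.changeCoord hA
  have hk' := subst_mem_annih hA hkm
  rw [hkg] at hk'
  rcases annih_or_hasRealZero hL' hg (by omega) (by omega) (by omega) (p := 2) (q := 1) rfl rfl
    hk' with h | h
  swap
  · exact HasRealZero.of_changeCoord hA h
  have hg' : conjP g ∈ annih (changeCoord A L) 2 1 2 3 := conjP_mem_annih hL' h
  have hfA := subst_mem_annih hA hf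
  have hfA0 : subst A f ≠ 0 := fun h => hf0 (subst_injective A hA (by rw [h, map_zero]))
  by_cases hi : LinearIndependent ℂ ![subst A f, conjP g]
  · refine HasRealZero.of_changeCoord hA ?_
    obtain ⟨e', he', k', hk'm, hk'0, hk'v⟩ := exists_mem_annih_evalX_eq_zero (n := 1) two_ne_zero
      (k := ![subst A f, conjP g]) (by intro a; fin_cases a; exacts [hfA, hg']) hi
    exact hasRealZero_of_annih_two_one_evalX hL' he' hk'0 hk'm hk'v
  · rw [LinearIndependent.pair_iff' hfA0] at hi
    push Not at hi
    obtain ⟨s, hs⟩ := hi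
    have hgs : g = C (starRingEnd ℂ s) * subst A (conjP f) := by
      rw [← conjP_conjP g, ← hs, ← conjP_subst, ← C_mul', map_mul, conjP_C]
    refine hcases (C (starRingEnd ℂ s) * subst A⁻¹ x₁) (C_mul_mem _ (subst_mem _ x1_mem)) ?_ ?_
    · apply subst_injective A hA
      rw [map_zero, ← hAe, ← evalX_subst, map_mul, subst_subst_inv hA, subst_C]
      simp
    · apply subst_injective A hA
      rw [hkg, hgs, map_mul, map_mul, subst_subst_inv hA, subst_C]
      ring

/-! ### Large kernels in bidegrees (3,1) and (2,2) -/

theorem hasRealZero_of_two_annih (hL : IsPPTFunctional L) {k : Fin 2 → BiPoly}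
    (hk : ∀ a, k a ∈ annih L 3 1 1 3) (hi : LinearIndependent ℂ k) : HasRealZero L := by
  obtain ⟨e, he, f, hf, hf0, hv⟩ := exists_mem_annih_evalX_eq_zero three_ne_zero hk hi
  obtain ⟨A, hA, g, hg, hg0, hfg⟩ := exists_coord_eq_x1_mul he hf.1 hf0 hv
  refine HasRealZero.of_changeCoord hA ?_
  have hL' := hL.changeCoord hA
  have hf' := subst_mem_annih hA hf
  rw [hfg] at hf'
  rcases annih_or_hasRealZero hL' hg (by omega) (by omega) (by omega) (p := 1) (q := 2) rfl rfl
    hf' with h | h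
  · exact hasRealZero_of_annih_two_one hL' hg0 h
  · exact h

/-- Forms of bidegree (2,2) have three coefficients in y, so three of them are dependent at some x.
The cofactor has bidegree (1,2), and its conjugate enters the (2,1) case. -/
theorem hasRealZero_of_three_annih (hL : IsPPTFunctional L) {k : Fin 3 → BiPoly}
    (hk : ∀ a, k a ∈ annih L 2 2 2 2) (hi : LinearIndependent ℂ k) : HasRealZero L := by
  obtain ⟨e, he, f, hf, hf0, hv⟩ := exists_mem_annih_evalX_eq_zero two_ne_zero hk hi
  obtain ⟨A, hA, g, hg, hg0, hfg⟩ := exists_coord_eq_x1_mul he hf.1 hf0 hv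
  refine HasRealZero.of_changeCoord hA ?_
  have hL' := hL.changeCoord hA
  have hf' := subst_mem_annih hA hf
  rw [hfg] at hf'
  rcases annih_or_hasRealZero hL' hg (by omega) (by omega) (by omega) (p := 2) (q := 1) rfl rfl
    hf' with h | h
  · exact hasRealZero_of_annih_two_one hL'
      (fun h0 => hg0 (by rw [← conjP_conjP g, h0, map_zero])) (conjP_mem_annih hL' h)
  · exact h

/-! ### Two-dimensional kernel in bidegree (2,2) -/

theorem evalAt_smul {m n : ℕ} {f : BiPoly} (hf : f ∈ bihom m n) (s t : ℂ) (a b : Fin 2 → ℂ) :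
    evalAt (s • a) (t • b) f = s ^ m * t ^ n * evalAt a b f := by
  induction hf using bihom_induction with
  | mon i j hi hj =>
    obtain ⟨i', rfl⟩ := Nat.exists_eq_add_of_le hi
    obtain ⟨j', rfl⟩ := Nat.exists_eq_add_of_le hj
    simp [biMon, mul_pow, pow_add]; ring
  | add f g _ _ h1 h2 => rw [map_add, h1, h2, map_add, mul_add]
  | zero => simp
  | smul c f _ h => rw [map_mul, h, map_mul, evalAt_C, evalAt_C]; ring

theorem exists_eq_y0_mul {m n : ℕ} {f : BiPoly} (hf : f ∈ bihom m (n + 1))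
    (h : evalX ![0, 1] (conjP f) = 0) : ∃ g ∈ bihom m n, f = y₀ * g := by
  obtain ⟨g, hg, e⟩ := exists_eq_x0_mul (conjP_mem hf) h
  refine ⟨conjP g, conjP_mem hg, ?_⟩
  rw [← conjP_conjP f, e, map_mul, conjP_x0]

theorem exists_factorization (u₀ u₁ u₂ : ℂ) :
    ∃ a₀ a₁ c₀ c₁ : ℂ, u₀ = a₀ * c₀ ∧ u₁ = a₀ * c₁ + a₁ * c₀ ∧ u₂ = a₁ * c₁ := by
  by_cases h : u₀ = 0
  · exact ⟨0, 1, u₁, u₂, by simp [h], by simp, by simp⟩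
  · obtain ⟨s, hs⟩ := IsAlgClosed.exists_pow_nat_eq (u₁ ^ 2 - 4 * u₀ * u₂) (n := 2) (by norm_num)
    refine ⟨u₀, (u₁ - s) / 2, 1, (u₁ + s) / (2 * u₀), by ring, by field_simp; ring, ?_⟩
    field_simp
    linear_combination hs

theorem exists_zero_quadratic (v₀ v₁ v₂ : ℂ) :
    ∃ b : Fin 2 → ℂ, b ≠ 0 ∧ v₀ * b 0 ^ 2 + v₁ * (b 0 * b 1) + v₂ * b 1 ^ 2 = 0 := by
  obtain ⟨a₀, a₁, c₀, c₁, rfl, rfl, rfl⟩ := exists_factorization v₀ v₁ v₂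
  by_cases h : a₀ = 0 ∧ a₁ = 0
  · exact ⟨![1, 0], vec_one_zero_ne_zero, by simp [h]⟩
  · refine ⟨![a₁, -a₀], fun h0 => h ⟨?_, ?_⟩, by simp; ring⟩
    · simpa using congrFun h0 1
    · simpa using congrFun h0 0

/-- Two binary quadratic forms with vanishing resultant have a common zero. -/
theorem exists_common_zero {u₀ u₁ u₂ v₀ v₁ v₂ : ℂ}
    (h : (u₀ * v₂ - u₂ * v₀) ^ 2 - (u₀ * v₁ - u₁ * v₀) * (u₁ * v₂ - u₂ * v₁) = 0) :
    ∃ b : Fin 2 → ℂ, b ≠ 0 ∧ u₀ * b 0 ^ 2 + u₁ * (b 0 * b 1) + u₂ * b 1 ^ 2 = 0 ∧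
      v₀ * b 0 ^ 2 + v₁ * (b 0 * b 1) + v₂ * b 1 ^ 2 = 0 := by
  obtain ⟨a₀, a₁, c₀, c₁, rfl, rfl, rfl⟩ := exists_factorization u₀ u₁ u₂
  by_cases ha : a₀ = 0 ∧ a₁ = 0
  · obtain ⟨b, hb, hv⟩ := exists_zero_quadratic v₀ v₁ v₂
    exact ⟨b, hb, by simp [ha], hv⟩
  by_cases hc : c₀ = 0 ∧ c₁ = 0
  · obtain ⟨b, hb, hv⟩ := exists_zero_quadratic v₀ v₁ v₂
    exact ⟨b, hb, by simp [hc], hv⟩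
  -- The resultant is the product of the values of the second form at the two roots of the first.
  have key : (v₀ * a₁ ^ 2 + v₁ * (a₁ * -a₀) + v₂ * (-a₀) ^ 2)
      * (v₀ * c₁ ^ 2 + v₁ * (c₁ * -c₀) + v₂ * (-c₀) ^ 2) = 0 := by
    linear_combination h
  rcases mul_eq_zero.mp key with h1 | h1
  · refine ⟨![a₁, -a₀], fun h0 => ha ⟨?_, ?_⟩, by simp; ring, by simpa using h1⟩
    · simpa using congrFun h0 1
    · simpa using congrFun h0 0
  · refine ⟨![c₁, -c₀], fun h0 => hc ⟨?_, ?_⟩, by simp; ring, by simpa using h1⟩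
    · simpa using congrFun h0 1
    · simpa using congrFun h0 0

/-- Two forms of bidegree `(2, 2)` have a common zero `(a, b)`. -/
theorem exists_common_zero_bihom {p q : BiPoly} (hp : p ∈ bihom 2 2) (hq : q ∈ bihom 2 2) :
    ∃ a b : Fin 2 → ℂ, a ≠ 0 ∧ b ≠ 0 ∧ evalAt a b p = 0 ∧ evalAt a b q = 0 := by
  obtain ⟨F, hF, hpF⟩ := exists_eq_sum_y hp
  obtain ⟨G, hG, hqG⟩ := exists_eq_sum_y hq
  have hb : ∀ i j k l, F i * G j - F k * G l ∈ bihom 4 0 := fun i j k l =>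
    sub_mem (bihom_mul (hF i) (hG j)) (bihom_mul (hF k) (hG l))
  -- The resultant with respect to y is a binary form of degree 8 in x.
  have hD : (F 0 * G 2 - F 2 * G 0) ^ 2 - (F 0 * G 1 - F 1 * G 0) * (F 1 * G 2 - F 2 * G 1)
      ∈ bihom 8 0 :=
    sub_mem (bihom_pow (hb _ _ _ _) 2) (bihom_mul (hb _ _ _ _) (hb _ _ _ _))
  obtain ⟨a, ha, hz⟩ := exists_zero_of_mem (by norm_num) hD
  have h1 := hz 0
  simp only [map_sub, map_mul, map_pow] at h1
  obtain ⟨b, hb0, hu, hv⟩ := exists_common_zero h1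
  have hev : ∀ (H : BiPoly), H ∈ bihom 2 0 → evalAt a b H = evalAt a 0 H := by
    intro H hH
    have := evalX_of_mem hH a 0
    rw [← evalAt_evalX a b 0, this, evalAt_C]
  refine ⟨a, b, ha, hb0, ?_, ?_⟩
  · rw [hpF, Fin.sum_univ_three]
    simp only [map_add, map_mul, hev _ (hF _)]
    simpa using hu
  · rw [hqG, Fin.sum_univ_three]
    simp only [map_add, map_mul, hev _ (hG _)]
    simpa using hv

/-- Two real forms of bidegree `(2, 2)` in the kernel with a common zero at `x = (1, 0)`,
`y = (0, 1)` produce an element of the kernel of bidegree `(3, 1)`. -/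
theorem eq_zero_of_nonreal_zero (hL : IsPPTFunctional L)
    (h3 : ∀ f ∈ annih L 3 1 1 3, f = 0) {p q : BiPoly} (hp : p ∈ annih L 2 2 2 2)
    (hq : q ∈ annih L 2 2 2 2) (hpr : conjP p = p) (hqr : conjP q = q) {s r d : ℂ}
    (hpe : evalX ![0, 1] p = C s * (y₀ * y₁))
    (hqe : evalX ![0, 1] q = C r * (y₀ * y₁) + C d * y₁ ^ 2)
    (hd : d ≠ 0) (hdr : starRingEnd ℂ d = d) : p = 0 := by
  set s' := starRingEnd ℂ s with hs'
  set r' := starRingEnd ℂ r with hr'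
  have hss : starRingEnd ℂ s' = s := Complex.conj_conj s
  have hrr : starRingEnd ℂ r' = r := Complex.conj_conj r
  -- The coefficients α and s̄x₀ are chosen so that αp - s̄x₀q vanishes at y = (0,1), hence equals
  -- y₀F with F of bidegree (3,1).
  set α := C r' * x₀ + C d * x₁ with hα
  have hαm : α ∈ bihom 1 0 := add_mem (C_mul_mem _ x0_mem) (C_mul_mem _ x1_mem)
  have hαc : conjP α = C r * y₀ + C d * y₁ := by simp [hα, hrr, hdr]
  have hGm : α * p - C s' * x₀ * q ∈ bihom 3 2 :=
    sub_mem (bihom_mul hαm hp.1) (bihom_mul (C_mul_mem _ x0_mem) hq.1)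
  have hGc : conjP (α * p - C s' * x₀ * q) = (C r * y₀ + C d * y₁) * p - C s * y₀ * q := by
    rw [map_sub, map_mul, hαc, hpr, map_mul, map_mul, hqr, conjP_C, hss, conjP_x0]
  obtain ⟨F, hF, hFG⟩ := exists_eq_y0_mul hGm (by
    rw [hGc]
    simp only [map_sub, map_mul, map_add, evalX_C, evalX_y0, evalX_y1, hpe, hqe]
    ring)
  have hFG' : x₀ * conjP F = (C r * y₀ + C d * y₁) * p - C s * y₀ * q := by
    rw [← hGc, hFG, map_mul, conjP_y0]
  have hFe : evalX ![0, 1] F = C (d * s) * y₁ := by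
    have h1 := congrArg (evalX ![0, 1]) hFG
    simp [hα, hpe] at h1
    refine mul_left_cancel₀ (X_ne_zero (R := ℂ) (2 : Fin 4)) ?_
    rw [← h1, C_mul]; ring
  -- The y₁ terms cancel the values at y = (0,1), so both forms are again divisible by y₀, with
  -- quotients of bidegree (2,2).
  have hA1 : α * conjP F - C (d * s') * y₁ * q ∈ bihom 2 3 :=
    sub_mem (bihom_mul hαm (conjP_mem hF)) (bihom_mul (C_mul_mem _ y1_mem) hq.1)
  have hB1 : C (d * s') * y₁ * p - C s' * x₀ * conjP F ∈ bihom 2 3 :=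
    sub_mem (bihom_mul (C_mul_mem _ y1_mem) hp.1)
      (bihom_mul (C_mul_mem _ x0_mem) (conjP_mem hF))
  obtain ⟨A, hA, hAe⟩ := exists_eq_y0_mul hA1 (by
    simp only [map_sub, map_mul, hαc, conjP_conjP, conjP_C, hss, hdr, conjP_y1, hqr, map_add,
      evalX_C, evalX_y0, evalX_y1, evalX_x1, hFe, hqe]
    simp
    ring)
  obtain ⟨B, hB, hBe⟩ := exists_eq_y0_mul hB1 (by
    simp only [map_sub, map_mul, conjP_conjP, conjP_C, hss, hdr, conjP_y1, conjP_x0, hpr,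
      evalX_C, evalX_y0, evalX_x1, hFe, hpe]
    simp
    ring)
  -- Now |F|² lies in the ideal of p and q with admissible cofactors, so L(|F|²) = 0 and F belongs
  -- to the trivial (3,1) kernel.
  have hFF : F * conjP F = p * A + q * B := by
    refine mul_left_cancel₀ (X_ne_zero (R := ℂ) (2 : Fin 4)) ?_
    linear_combination -conjP F * hFG + p * hAe + q * hBe
  have hF0 : F = 0 := by
    refine h3 F (mem_annih_of_norm_eq_zero hL rfl hF ?_)
    rw [hFF, map_add, hp.2 A hA, hq.2 B hB, add_zero]
  have hs0 : s = 0 := by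
    rw [hF0, map_zero] at hFe
    have h1 := (mul_eq_zero.mp hFe.symm).resolve_right (X_ne_zero _)
    exact (mul_eq_zero.mp (C_eq_zero.mp h1)).resolve_left hd
  have hα0 : α ≠ 0 := by
    intro h
    have := congrArg (evalAt ![0, 1] 0) h
    simp [hα] at this
    exact hd this
  rw [hF0, mul_zero, hs', hs0] at hFG
  simpa [hα0] using hFG

theorem evalX_zero_one_of_mem {q : BiPoly} (hq : q ∈ bihom 2 2)
    (h : evalAt ![0, 1] ![1, 0] q = 0) :
    ∃ r, evalX ![0, 1] q = C r * (y₀ * y₁) + C (evalAt ![0, 1] ![0, 1] q) * y₁ ^ 2 := by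
  obtain ⟨γ, rfl⟩ := exists_eq_polyOf hq
  refine ⟨γ (2, 1), ?_⟩
  simp [polyOf, biMon, Fintype.sum_prod_type, Fin.sum_univ_three] at h ⊢
  rw [h]

theorem star_evalAt_of_real {q : BiPoly} (hq : conjP q = q) (a b : Fin 2 → ℂ) :
    starRingEnd ℂ (evalAt (star b) (star a) q) = evalAt a b q := by
  rw [← evalAt_conjP, hq]

/-- A two-dimensional kernel of bidegree `(2, 2)` has a common real zero when the other kernels
are trivial. -/
theorem hasRealZero_of_pencil (hL : IsPPTFunctional L) (h4 : ∀ f ∈ annih L 4 0 0 4, f = 0)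
    (h3 : ∀ f ∈ annih L 3 1 1 3, f = 0) {p q : BiPoly} (hp : p ∈ annih L 2 2 2 2)
    (hq : q ∈ annih L 2 2 2 2) (hpr : conjP p = p) (hqr : conjP q = q)
    (hi : LinearIndependent ℂ ![p, q])
    (hs : ∀ f ∈ annih L 2 2 2 2, ∃ s t : ℂ, f = C s * p + C t * q) : HasRealZero L := by
  have hfin : ∀ e : Fin 2 → ℂ, e ≠ 0 → evalAt e (star e) p = 0 → evalAt e (star e) q = 0 →
      HasRealZero L := by
    intro e he hpe hqe
    refine hasRealZero_of hL he (fun f hf => by rw [h4 f hf, map_zero])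
      (fun f hf => by rw [h3 f hf, map_zero]) fun f hf => ?_
    obtain ⟨s, t, rfl⟩ := hs f hf
    simp [hpe, hqe]
  obtain ⟨a, b, ha, hb, hpz, hqz⟩ := exists_common_zero_bihom hp.1 hq.1
  -- If b is proportional to ā, bihomogeneity turns (a, b) into the real point (a, ā).
  by_cases hdet : a 0 * star (b 1) - a 1 * star (b 0) = 0
  · obtain ⟨t, rfl⟩ : ∃ t : ℂ, b = t • star a := by
      have hdet' : star (a 0) * b 1 - star (a 1) * b 0 = 0 := by
        simpa using congrArg star hdet
      by_cases h0 : a 0 = 0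
      · have h1 : a 1 ≠ 0 := fun h1 => ha (by funext i; fin_cases i <;> simp [h0, h1])
        have h1' : star (a 1) ≠ 0 := star_ne_zero.mpr h1
        refine ⟨b 1 / star (a 1), ?_⟩
        have hb0 : b 0 = 0 := by simpa [h0, h1] using hdet'
        funext i; fin_cases i
        · simp [h0, hb0]
        · simp only [Fin.mk_one, Pi.smul_apply, Pi.star_apply, smul_eq_mul]
          field_simp
      · have h0' : star (a 0) ≠ 0 := star_ne_zero.mpr h0
        refine ⟨b 0 / star (a 0), ?_⟩
        funext i; fin_cases i
        · simp only [Fin.zero_eta, Pi.smul_apply, Pi.star_apply, smul_eq_mul]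
          field_simp
        · simp only [Fin.mk_one, Pi.smul_apply, Pi.star_apply, smul_eq_mul]
          field_simp
          linear_combination hdet'
    have ht : t ≠ 0 := fun h => hb (by simp [h])
    have hh : ∀ f ∈ bihom 2 2, evalAt a (t • star a) f = 0 → evalAt a (star a) f = 0 := by
      intro f hf h
      have := evalAt_smul hf 1 t a (star a)
      rw [one_smul, h] at this
      simpa [ht] using this.symm
    exact hfin a ha (hh p hp.1 hpz) (hh q hq.1 hqz)
  -- A sends (1,0) to a and (0,1) to b̄, so the common zero becomes x = (1,0), y = (0,1). Reality of
  -- p and q adds the zero x = (0,1), y = (1,0).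
  · set A : Matrix (Fin 2) (Fin 2) ℂ := !![a 0, star (b 0); a 1, star (b 1)] with hAdef
    have hA : IsUnit A.det := by
      rw [isUnit_iff_ne_zero, hAdef, Matrix.det_fin_two_of]
      intro h; apply hdet; linear_combination h
    have hA1 : A.mulVec ![0, 1] = star b := by
      funext i; fin_cases i <;> simp [hAdef]
    have hev : ∀ f, evalAt ![1, 0] ![0, 1] (subst A f) = evalAt a b f := by
      intro f
      have : (evalAt ![1, 0] ![0, 1]).comp (subst A) = evalAt a b := by
        apply MvPolynomial.algHom_ext
        intro i; fin_cases i <;> simp [hAdef]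
      exact congrArg (fun φ => φ f) this
    have hs01 : star (![0, 1] : Fin 2 → ℂ) = ![0, 1] := by
      funext i; fin_cases i <;> simp
    have hev1 : ∀ f, evalAt ![0, 1] ![0, 1] (subst A f) = evalAt (star b) (star (star b)) f := by
      intro f
      have := evalAt_subst A ![0, 1] f
      rwa [hs01, hA1] at this
    have hL' := hL.changeCoord hA
    have h3' : ∀ f ∈ annih (changeCoord A L) 3 1 1 3, f = 0 := by
      intro f hf
      have h1 : subst A⁻¹ f ∈ annih L 3 1 1 3 := by
        refine ⟨subst_mem _ hf.1, fun h hh => ?_⟩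
        have := hf.2 (subst A h) (subst_mem _ hh)
        rwa [changeCoord_apply, map_mul, subst_inv_subst hA] at this
      rw [← subst_subst_inv hA f, h3 _ h1, map_zero]
    by_cases hboth : evalAt (star b) (star (star b)) p = 0 ∧ evalAt (star b) (star (star b)) q = 0
    · exact hfin (star b) (star_ne_zero.mpr hb) hboth.1 hboth.2
    exfalso
    have main : ∀ p q : BiPoly, p ∈ annih L 2 2 2 2 → q ∈ annih L 2 2 2 2 → conjP p = p →
        conjP q = q → evalAt a b p = 0 → evalAt a b q = 0 →
        evalAt (star b) (star (star b)) q ≠ 0 → ∃ s t : ℂ, s ≠ 0 ∧ C s * p + C t * q = 0 := by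
      intro p q hp hq hpr hqr hpz hqz hd
      set d := evalAt (star b) (star (star b)) q with hddef
      set d' := evalAt (star b) (star (star b)) p with hd'def
      have hdr : starRingEnd ℂ d = d := by
        have := star_evalAt_of_real hqr (star b) (star (star b))
        rwa [star_star] at this
      have hdr' : starRingEnd ℂ d' = d' := by
        have := star_evalAt_of_real hpr (star b) (star (star b))
        rwa [star_star] at this
      have hz10 : ∀ f : BiPoly, conjP f = f → evalAt a b f = 0 →
          evalAt ![0, 1] ![1, 0] (subst A f) = 0 := by
        intro f hf h
        have h1 := star_evalAt_of_real (q := subst A f) (by rw [conjP_subst, hf]) ![0, 1] ![1, 0]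
        rw [hs01, star_vec_one_zero, hev, h, map_zero] at h1
        exact h1.symm
      -- This real member of the pencil also vanishes at the real point given by b̄;
      -- `eq_zero_of_nonreal_zero` makes it zero, against independence.
      set P := C d * p + C (-d') * q with hP
      have hPm : P ∈ annih L 2 2 2 2 := by
        rw [hP, C_mul', C_mul']
        exact add_mem (Submodule.smul_mem _ _ hp) (Submodule.smul_mem _ _ hq)
      have hPr : conjP P = P := by
        rw [hP]; simp only [map_add, map_mul, conjP_C, map_neg, hdr, hdr', hpr, hqr]
      have hPz : evalAt a b P = 0 := by simp [hP, hpz, hqz]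
      have hP1 : evalAt (star b) (star (star b)) P = 0 := by
        rw [hP, map_add, map_mul, map_mul, evalAt_C, evalAt_C]
        ring
      obtain ⟨r, hr⟩ := evalX_zero_one_of_mem (subst_mem A hq.1) (hz10 q hqr hqz)
      obtain ⟨s, hs⟩ := evalX_zero_one_of_mem (subst_mem A hPm.1) (hz10 P hPr hPz)
      rw [hev1] at hr hs
      rw [hP1, C_0, zero_mul, add_zero] at hs
      have h0 := eq_zero_of_nonreal_zero hL' h3' (subst_mem_annih hA hPm) (subst_mem_annih hA hq)
        (by rw [conjP_subst, hPr]) (by rw [conjP_subst, hqr]) hs hr hd hdr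
      exact ⟨d, -d', hd, subst_injective A hA (by rw [h0, map_zero])⟩
    rw [LinearIndependent.pair_iff] at hi
    by_cases hq0 : evalAt (star b) (star (star b)) q = 0
    · have hp0 : evalAt (star b) (star (star b)) p ≠ 0 := fun h => hboth ⟨h, hq0⟩
      obtain ⟨s, t, hs0, h⟩ := main q p hq hp hqr hpr hqz hpz hp0
      exact hs0 (hi t s (by rw [← C_mul', ← C_mul', add_comm]; exact h)).2
    · obtain ⟨s, t, hs0, h⟩ := main p q hp hq hpr hqr hpz hqz hq0
      exact hs0 (hi s t (by rw [← C_mul', ← C_mul']; exact h)).1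

/-! ### Winding number of a form of bidegree (3,1) -/

theorem continuous_evalAt {T : Type*} [TopologicalSpace T] {u v : T → Fin 2 → ℂ}
    (hu : Continuous u) (hv : Continuous v) (f : BiPoly) :
    Continuous fun t => evalAt (u t) (v t) f := by
  induction f using MvPolynomial.induction_on with
  | C a => simpa using continuous_const
  | add f g h1 h2 => simp only [map_add]; exact h1.add h2
  | mul_X f i h =>
    simp only [map_mul]
    refine h.mul ?_
    fin_cases i <;> simp <;> fun_prop

/-- Sections of degree `3 - 1 = 2` over the sphere have a zero: a form of bidegree `(3, 1)` has a
zero of the form `(e, conj e)`. -/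
theorem exists_real_zero_three_one {G : BiPoly} (hG : G ∈ bihom 3 1) :
    ∃ e : Fin 2 → ℂ, e ≠ 0 ∧ evalAt e (star e) G = 0 := by
  by_contra! hne
  set g : ℂ → ℂ := fun z => evalAt ![1, z] (star ![1, z]) G with hg
  set N : ℂ → ℂ := fun s => evalAt ![s, 1] (star ![s, 1]) G with hN
  have hgc : Continuous g := by
    have hu : Continuous fun z : ℂ => (![1, z] : Fin 2 → ℂ) := by
      refine continuous_pi fun i => ?_
      fin_cases i
      · exact continuous_const
      · exact continuous_id
    exact continuous_evalAt hu hu.star G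
  have hNc : Continuous N := by
    have hu : Continuous fun z : ℂ => (![z, 1] : Fin 2 → ℂ) := by
      refine continuous_pi fun i => ?_
      fin_cases i
      · exact continuous_id
      · exact continuous_const
    exact continuous_evalAt hu hu.star G
  have hg0 : ∀ z, g z ≠ 0 := fun z => hne _ fun h => by simpa using congrFun h 0
  have hN0 : ∀ z, N z ≠ 0 := fun z => hne _ fun h => by simpa using congrFun h 1
  -- Near infinity N(1/z) is close to N(0) ≠ 0, so g winds 3 - 1 = 2 times along a large circle,
  -- although a nowhere vanishing g on the plane has a continuous logarithm.
  have hgN : ∀ z : ℂ, z ≠ 0 → g z = z ^ 3 * starRingEnd ℂ z * N z⁻¹ := by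
    intro z hz
    have h1 : (![1, z] : Fin 2 → ℂ) = z • ![z⁻¹, 1] := by
      funext i; fin_cases i <;> simp [hz]
    simp only [hg, hN]
    rw [h1, star_smul, evalAt_smul hG]
    simp
  set c := N 0 with hc
  have hc0 : c ≠ 0 := hN0 0
  obtain ⟨δ, hδ, hball⟩ := Metric.continuous_iff.mp hNc 0 ‖c‖ (norm_pos_iff.mpr hc0)
  have hsc : IsSimplyConnected (Set.univ : Set ℂ) := by
    have := convex_univ.contractibleSpace (Set.univ_nonempty (α := ℂ))
    exact SimplyConnectedSpace.ofContractible _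
  obtain ⟨h, hcont, hexp⟩ := Complex.exists_continuousOn_eqOn_exp_comp
    hsc isOpen_univ hgc.continuousOn (by rintro ⟨z, -, hz⟩; exact hg0 z hz)
  rw [continuousOn_univ] at hcont
  have hexp' : ∀ z, Complex.exp (h z) = g z := fun z => hexp (Set.mem_univ z)
  -- On this circle |1/ζ| = δ/2 < δ, so N(1/ζ)/c stays within distance 1 of 1 and has a continuous
  -- principal logarithm.
  set R : ℝ := 2 / δ with hR
  have hRpos : 0 < R := by positivity
  set ζ : ℝ → ℂ := fun θ => R * Complex.exp (θ * Complex.I) with hζ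
  have hζ0 : ∀ θ, ζ θ ≠ 0 := fun θ =>
    mul_ne_zero (by exact_mod_cast hRpos.ne') (Complex.exp_ne_zero _)
  have hζn : ∀ θ, ‖(ζ θ)⁻¹‖ < δ := by
    intro θ
    rw [norm_inv, hζ, norm_mul, Complex.norm_exp_ofReal_mul_I, mul_one, Complex.norm_real,
      Real.norm_of_nonneg hRpos.le, hR, inv_div]
    linarith
  have hζc : Continuous ζ := by fun_prop
  have hslit : ∀ θ, N (ζ θ)⁻¹ / c ∈ Complex.slitPlane := by
    intro θ
    have h1 := hball (ζ θ)⁻¹ (by simpa using hζn θ)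
    rw [dist_eq_norm] at h1
    refine Complex.mem_slitPlane_of_norm_lt_one (z := N (ζ θ)⁻¹ / c - 1) ?_ |> fun h => by
      simpa using h
    rw [div_sub_one hc0, norm_div, div_lt_one (norm_pos_iff.mpr hc0)]
    exact h1
  -- Λ is a continuous logarithm of the constant R⁴c, yet it changes by -4πi around the circle.
  set Λ : ℝ → ℂ := fun θ => h (ζ θ) - 2 * θ * Complex.I - Complex.log (N (ζ θ)⁻¹ / c) with hΛ
  have hΛc : Continuous Λ := by
    refine ((hcont.comp hζc).sub (by fun_prop)).sub ?_
    exact Continuous.clog ((hNc.comp (hζc.inv₀ hζ0)).div_const c) hslit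
  have hΛexp : ∀ θ, Complex.exp (Λ θ) = R ^ 4 * c := by
    intro θ
    have hE : Complex.exp (θ * Complex.I) ≠ 0 := Complex.exp_ne_zero _
    have hconj : starRingEnd ℂ (ζ θ) = R * (Complex.exp (θ * Complex.I))⁻¹ := by
      rw [hζ, map_mul, Complex.conj_ofReal, ← Complex.exp_conj, ← Complex.exp_neg]
      simp
    have h2 : Complex.exp (2 * θ * Complex.I) = Complex.exp (θ * Complex.I) ^ 2 := by
      rw [← Complex.exp_nat_mul]; congr 1; push_cast; ring
    rw [hΛ, Complex.exp_sub, Complex.exp_sub, hexp', hgN _ (hζ0 θ), hconj,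
      Complex.exp_log (div_ne_zero (hN0 _) hc0), h2]
    have := hN0 (ζ θ)⁻¹
    generalize N (ζ θ)⁻¹ = n at this
    simp only [hζ]
    field_simp
  have hper : ζ (2 * Real.pi) = ζ 0 := by
    simp [hζ]
  have hΛ2 : Λ (2 * Real.pi) = Λ 0 - 4 * Real.pi * Complex.I := by
    simp only [hΛ, hper]; push_cast; ring
  have him : (Λ (2 * Real.pi)).im = (Λ 0).im - 4 * Real.pi := by
    rw [hΛ2]; simp
  -- Im Λ passes through Im Λ(0) - π, where the exponential would have changed sign.
  obtain ⟨θ, -, hθ⟩ := intermediate_value_Icc' (f := fun θ => (Λ θ).im) (by positivity)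
    (Complex.continuous_im.comp hΛc).continuousOn
    (show (Λ 0).im - Real.pi ∈ Set.Icc (Λ (2 * Real.pi)).im (Λ 0).im by
      rw [him]; constructor <;> linarith [Real.pi_pos])
  have h1 : Complex.exp (Λ θ - Λ 0) = 1 := by
    rw [Complex.exp_sub, hΛexp, hΛexp, div_self]
    exact mul_ne_zero (pow_ne_zero _ (by exact_mod_cast hRpos.ne')) hc0
  have h2 : (Λ θ - Λ 0).im = -Real.pi := by
    rw [Complex.sub_im]
    have : (Λ θ).im = (Λ 0).im - Real.pi := hθ
    linarith
  have h3 := congrArg Complex.re h1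
  rw [Complex.exp_re, h2, Real.cos_neg, Real.cos_pi, Complex.one_re] at h3
  linarith [Real.exp_pos (Λ θ - Λ 0).re]

/-! ### Point evaluations and the one-dimensional kernel in bidegree (2,2) -/

/-- The quadratic form defining the light cone. -/
def coneForm (v : Fin 4 → ℝ) : ℝ := 4 * v 0 * v 1 - v 2 ^ 2 - v 3 ^ 2

theorem sum_coneForm {n : ℕ} (x : Fin n → Fin 4 → ℝ) :
    ∑ k, coneForm (x k) = 4 * ∑ k, x k 0 * x k 1 - ∑ k, x k 2 * x k 2 - ∑ k, x k 3 * x k 3 := by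
  simp only [coneForm, Finset.sum_sub_distrib, Finset.mul_sum, ← mul_assoc, sq]

/-- A sum of squares `∑ xₖ xₖᵀ` on which the cone form has mean zero can be written with vectors
from the cone. -/
theorem exists_null_decomposition {n : ℕ} (x : Fin n → Fin 4 → ℝ)
    (h : ∑ k, coneForm (x k) = 0) :
    ∃ y : Fin n → Fin 4 → ℝ, (∀ k, coneForm (y k) = 0) ∧
      ∀ i j, ∑ k, y k i * y k j = ∑ k, x k i * x k j := by
  classical
  induction hN : (Finset.univ.filter fun k => coneForm (x k) ≠ 0).card using Nat.strong_induction_on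
    generalizing x with
  | _ N ih =>
    by_cases hall : ∀ k, coneForm (x k) = 0
    · exact ⟨x, hall, fun _ _ => rfl⟩
    push Not at hall
    obtain ⟨k₀, hk₀⟩ := hall
    obtain ⟨a, ha⟩ : ∃ a, 0 < coneForm (x a) := by
      by_contra! hc
      exact hk₀ ((Finset.sum_eq_zero_iff_of_nonpos fun k _ => hc k).mp h k₀ (Finset.mem_univ _))
    obtain ⟨b, hb⟩ : ∃ b, coneForm (x b) < 0 := by
      by_contra! hc
      exact hk₀ ((Finset.sum_eq_zero_iff_of_nonneg fun k _ => hc k).mp h k₀ (Finset.mem_univ _))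
    have hab : a ≠ b := by rintro rfl; linarith
    -- Rotating the pair (x a, x b) preserves ∑ xₖxₖᵀ. At a suitable angle the first vector becomes
    -- null, so fewer vectors lie off the cone.
    obtain ⟨θ, -, hθ⟩ := intermediate_value_Icc' (a := 0) (b := Real.pi / 2)
      (f := fun θ => coneForm (fun i => Real.cos θ * x a i + Real.sin θ * x b i))
      (by positivity) (by unfold coneForm; fun_prop)
      (show (0 : ℝ) ∈ _ by simpa using ⟨hb.le, ha.le⟩)
    have hcs := Real.sin_sq_add_cos_sq θ
    set c := Real.cos θ
    set s := Real.sin θ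
    set y : Fin n → Fin 4 → ℝ := Function.update
      (Function.update x a fun i => c * x a i + s * x b i) b fun i => c * x b i - s * x a i with hy
    have hya : y a = fun i => c * x a i + s * x b i := by simp [hy, hab]
    have hyb : y b = fun i => c * x b i - s * x a i := by simp [hy]
    have hyk : ∀ k, k ≠ a → k ≠ b → y k = x k := fun k h1 h2 => by simp [hy, h1, h2]
    have hmom : ∀ i j, ∑ k, y k i * y k j = ∑ k, x k i * x k j := by
      intro i j
      have hb' : b ∈ Finset.univ.erase a := by simp [hab.symm]
      rw [← Finset.add_sum_erase _ _ (Finset.mem_univ a), ← Finset.add_sum_erase _ _ hb',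
        ← Finset.add_sum_erase (a := a) _ (fun k => x k i * x k j) (Finset.mem_univ a),
        ← Finset.add_sum_erase _ (fun k => x k i * x k j) hb']
      have hrest : ∑ k ∈ (Finset.univ.erase a).erase b, y k i * y k j
          = ∑ k ∈ (Finset.univ.erase a).erase b, x k i * x k j := by
        refine Finset.sum_congr rfl fun k hk => ?_
        simp only [Finset.mem_erase, Finset.mem_univ, and_true] at hk
        rw [hyk k hk.2 hk.1]
      rw [hrest, hya, hyb]
      linear_combination (x a i * x a j + x b i * x b j) * hcs
    have hsum : ∑ k, coneForm (y k) = 0 := by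
      rw [sum_coneForm, hmom, hmom, hmom, ← sum_coneForm, h]
    have hya0 : coneForm (y a) = 0 := by rw [hya]; exact hθ
    have hlt : (Finset.univ.filter fun k => coneForm (y k) ≠ 0).card < N := by
      rw [← hN]
      refine Finset.card_lt_card ⟨fun k hk => ?_, fun hsub => ?_⟩
      · simp only [Finset.mem_filter, Finset.mem_univ, true_and] at hk ⊢
        by_cases h1 : k = a
        · rw [h1]; exact ha.ne'
        by_cases h2 : k = b
        · rw [h2]; exact hb.ne
        rwa [hyk k h1 h2] at hk
      · have := hsub (show a ∈ _ by simpa using ha.ne')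
        simp [hya0] at this
    obtain ⟨z, hz, hzm⟩ := ih _ hlt y hsum rfl
    exact ⟨z, hz, fun i j => by rw [hzm, hmom]⟩

/-- A real basis of the forms of bidegree `(1, 1)`. -/
noncomputable def realBasis : Fin 4 → BiPoly :=
  ![x₀ * y₀, x₁ * y₁, x₀ * y₁ + x₁ * y₀, C Complex.I * (x₀ * y₁ - x₁ * y₀)]

theorem realBasis_mem (i : Fin 4) : realBasis i ∈ bihom 1 1 := by
  have h : ∀ {u v : BiPoly}, u ∈ bihom 1 0 → v ∈ bihom 0 1 → u * v ∈ bihom 1 1 :=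
    fun hu hv => bihom_mul hu hv
  fin_cases i
  · exact h x0_mem y0_mem
  · exact h x1_mem y1_mem
  · exact add_mem (h x0_mem y1_mem) (h x1_mem y0_mem)
  · exact C_mul_mem _ (sub_mem (h x0_mem y1_mem) (h x1_mem y0_mem))

theorem conjP_realBasis (i : Fin 4) : conjP (realBasis i) = realBasis i := by
  fin_cases i <;> simp [realBasis] <;> ring

theorem exists_eq_sum_realBasis {u : BiPoly} (hu : u ∈ bihom 1 1) :
    ∃ α : Fin 4 → ℂ, u = ∑ i, C (α i) * realBasis i := by
  obtain ⟨c, rfl⟩ := exists_eq_polyOf hu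
  refine ⟨![c (0, 0), c (1, 1), (c (0, 1) + c (1, 0)) * (1 / 2),
    -Complex.I * (c (0, 1) - c (1, 0)) * (1 / 2)], ?_⟩
  have hI : (C Complex.I : BiPoly) * C Complex.I = -1 := by
    rw [← C_mul, Complex.I_mul_I]; simp
  have h2 : (C (1 / 2) : BiPoly) * 2 = 1 := by
    rw [show (2 : BiPoly) = C 2 from (map_ofNat C 2).symm, ← C_mul]; norm_num
  have he : polyOf 1 1 c = C (c (0, 0)) * (x₀ * y₀) + C (c (0, 1)) * (x₀ * y₁)
      + C (c (1, 0)) * (x₁ * y₀) + C (c (1, 1)) * (x₁ * y₁) := by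
    simp [polyOf, biMon, Fintype.sum_prod_type]; ring
  rw [he, Fin.sum_univ_four]
  simp only [realBasis, Matrix.cons_val, C_mul, C_add, C_sub, C_neg]
  linear_combination ((C (c (0, 1)) - C (c (1, 0))) * C (1 / 2) * (x₀ * y₁ - x₁ * y₀)) * hI
    - (C (c (0, 1)) * x₀ * y₁ + C (c (1, 0)) * x₁ * y₀) * h2

/-- Vectors of the light cone come from points of `ℂ²`. -/
theorem exists_point_of_coneForm_eq_zero {y : Fin 4 → ℝ} (hy : coneForm y = 0) :
    ∃ e : Fin 2 → ℂ, ∀ i j, evalAt e (star e) (realBasis i) * evalAt e (star e) (realBasis j)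
      = (y i * y j : ℝ) := by
  have main : ∀ y : Fin 4 → ℝ, coneForm y = 0 → 0 ≤ y 0 → 0 ≤ y 1 →
      ∃ e : Fin 2 → ℂ, ∀ i, evalAt e (star e) (realBasis i) = (y i : ℝ) := by
    intro y hy h0 h1
    unfold coneForm at hy
    rcases h0.eq_or_lt with h0 | h0
    · have h2 : y 2 = 0 := by nlinarith [sq_nonneg (y 2), sq_nonneg (y 3)]
      have h3 : y 3 = 0 := by nlinarith [sq_nonneg (y 2), sq_nonneg (y 3)]
      refine ⟨![0, (Real.sqrt (y 1) : ℂ)], fun i => ?_⟩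
      have hs : (Real.sqrt (y 1) : ℂ) * Real.sqrt (y 1) = y 1 := by
        rw [← Complex.ofReal_mul, Real.mul_self_sqrt h1]
      fin_cases i <;> simp [realBasis, ← h0, h2, h3, hs]
    · set r := Real.sqrt (y 0) with hr
      have hrr : (r : ℂ) * r = y 0 := by
        rw [← Complex.ofReal_mul, Real.mul_self_sqrt h0.le]
      have hr0 : (r : ℂ) ≠ 0 := by
        have : 0 < r := Real.sqrt_pos.mpr h0
        exact_mod_cast this.ne'
      have hyc : (4 : ℂ) * y 0 * y 1 - (y 2 : ℂ) ^ 2 - (y 3 : ℂ) ^ 2 = 0 := by exact_mod_cast hy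
      refine ⟨![(r : ℂ), (y 2 + Complex.I * y 3) / (2 * r)], fun i => ?_⟩
      fin_cases i
      · simp [realBasis, hrr]
      · simp [realBasis]
        field_simp
        linear_combination (-(y 3 : ℂ) ^ 2) * Complex.I_sq - hyc - 4 * (y 1 : ℂ) * hrr
      · simp [realBasis]
        field_simp
        ring
      · simp [realBasis]
        field_simp
        linear_combination (-2 * (y 3 : ℂ)) * Complex.I_sq
  -- On the cone y 0 and y 1 have the same sign, and passing to -y does not change the products y i
  -- * y j.
  have hprod : 0 ≤ y 0 * y 1 := by
    unfold coneForm at hy; nlinarith [sq_nonneg (y 2), sq_nonneg (y 3)]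
  by_cases hpos : 0 ≤ y 0 ∧ 0 ≤ y 1
  · obtain ⟨e, he⟩ := main y hy hpos.1 hpos.2
    exact ⟨e, fun i j => by rw [he, he]; push_cast; ring⟩
  · have hneg : y 0 ≤ 0 ∧ y 1 ≤ 0 := by
      by_contra hc
      rcases not_and_or.mp hpos with h | h <;> rcases not_and_or.mp hc with h' | h' <;>
        push Not at h h' <;> first | linarith | nlinarith
    obtain ⟨e, he⟩ := main (-y) (by unfold coneForm at *; simpa using hy)
      (by simpa using hneg.1) (by simpa using hneg.2)
    exact ⟨e, fun i j => by rw [he, he]; simp⟩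

/-- The restriction of a PPT functional to forms of bidegree `(2, 2)` (multiplied by
`x₀² y₀²`) is a sum of point evaluations. -/
theorem exists_eq_sum_evalAt (hL : IsPPTFunctional L) :
    ∃ (n : ℕ) (e : Fin n → Fin 2 → ℂ), ∀ f ∈ bihom 2 2,
      L (f * (x₀ ^ 2 * y₀ ^ 2)) = ∑ k, evalAt (e k) (star (e k)) f := by
  set w : BiPoly := x₀ ^ 2 * y₀ ^ 2 with hw
  set M : Matrix (Fin 4) (Fin 4) ℝ := fun i j => (L (realBasis i * realBasis j * w)).re with hM
  have hMreal : ∀ i j, L (realBasis i * realBasis j * w) = (M i j : ℂ) := by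
    intro i j
    have h1 := hL.conj (realBasis i * realBasis j * w)
    have h2 : conjP w = w := by simp [hw]; ring
    rw [map_mul conjP, map_mul conjP, conjP_realBasis, conjP_realBasis, h2] at h1
    exact (Complex.conj_eq_iff_re.mp h1.symm).symm
  -- M is the Gram matrix of the real forms `realBasis i` · x₀y₀ of bidegree (2,2), since w =
  -- (x₀y₀)².
  have hpsd : M.PosSemidef := by
    refine Matrix.posSemidef_iff_dotProduct_mulVec.mpr ⟨?_, fun t => ?_⟩
    · ext i j
      rw [Matrix.conjTranspose_apply, star_trivial]
      show (L (realBasis j * realBasis i * w)).re = (L (realBasis i * realBasis j * w)).re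
      rw [mul_comm (realBasis j)]
    · set u : BiPoly := (∑ i, C (t i : ℂ) * realBasis i) * (x₀ * y₀) with hu
      have hum : u ∈ bihom 2 2 :=
        bihom_mul (sum_mem fun i _ => C_mul_mem _ (realBasis_mem i))
          (bihom_mul x0_mem y0_mem rfl rfl)
      have h1 := hL.nonneg rfl hum
      have h2 : u * conjP u = ∑ i, ∑ j, C (t i * t j : ℂ) * (realBasis i * realBasis j * w) := by
        have hc : conjP u = u := by
          simp [hu, conjP_realBasis, mul_comm]
        rw [hc, hu, hw]
        have : ∀ S : BiPoly, S * (x₀ * y₀) * (S * (x₀ * y₀)) = S * S * (x₀ ^ 2 * y₀ ^ 2) :=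
          fun S => by ring
        rw [this, Finset.sum_mul_sum, Finset.sum_mul]
        refine Finset.sum_congr rfl fun i _ => ?_
        rw [Finset.sum_mul]
        refine Finset.sum_congr rfl fun j _ => ?_
        rw [C_mul]; ring
      rw [h2] at h1
      simp only [map_sum, map_C_mul, hMreal] at h1
      have h3 : ∑ i, ∑ j, (t i * t j * (M i j : ℂ) : ℂ)
          = ((∑ i, ∑ j, t i * t j * M i j : ℝ) : ℂ) := by push_cast; rfl
      rw [h3, Complex.ofReal_re] at h1
      refine h1.trans_eq ?_
      simp only [dotProduct, Matrix.mulVec, Finset.mul_sum, star_trivial]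
      exact Finset.sum_congr rfl fun i _ => Finset.sum_congr rfl fun j _ => by ring
  obtain ⟨n, v, hv⟩ := Matrix.posSemidef_iff_eq_sum_vecMulVec.mp hpsd
  have hMv : ∀ i j, M i j = ∑ k, v k i * v k j := by
    intro i j
    rw [hv, Matrix.sum_apply]
    simp [Matrix.vecMulVec_apply]
  -- This is L applied to w times the relation 4b₀b₁ = b₂² + b₃² between the basis forms.
  have hcone : ∑ k, coneForm (v k) = 0 := by
    rw [sum_coneForm, ← hMv, ← hMv, ← hMv]
    have h1 : C 4 * (realBasis 0 * realBasis 1 * w)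
        = realBasis 2 * realBasis 2 * w + realBasis 3 * realBasis 3 * w := by
      have hI : (C Complex.I : BiPoly) * C Complex.I = -1 := by
        rw [← C_mul, Complex.I_mul_I]; simp
      rw [show (C 4 : BiPoly) = 4 from map_ofNat C 4]
      simp only [realBasis, Matrix.cons_val]
      linear_combination -(x₀ * y₁ - x₁ * y₀) ^ 2 * w * hI
    have h2 := congrArg L h1
    rw [map_C_mul, map_add, hMreal, hMreal, hMreal] at h2
    have h3 : 4 * M 0 1 = M 2 2 + M 3 3 := by exact_mod_cast h2
    linarith
  obtain ⟨y, hy, hym⟩ := exists_null_decomposition v hcone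
  choose e he using fun k => exists_point_of_coneForm_eq_zero (hy k)
  refine ⟨n, e, fun f hf => ?_⟩
  have hzero : (L.comp (LinearMap.mulRight ℂ w)
      - ∑ k, (evalAt (e k) (star (e k))).toLinearMap : BiPoly →ₗ[ℂ] ℂ) f = 0 := by
    refine map_eq_zero_of_forall_mul (a := 1) (b := 1) (p := 1) (q := 1) rfl rfl
      (fun a ha b hb => ?_) hf
    obtain ⟨α, rfl⟩ := exists_eq_sum_realBasis ha
    obtain ⟨β, rfl⟩ := exists_eq_sum_realBasis hb
    have hterm : ∀ i j, (L.comp (LinearMap.mulRight ℂ w)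
        - ∑ k, (evalAt (e k) (star (e k))).toLinearMap : BiPoly →ₗ[ℂ] ℂ)
          (realBasis i * realBasis j) = 0 := by
      intro i j
      rw [LinearMap.sub_apply, LinearMap.comp_apply, LinearMap.mulRight_apply, hMreal,
        LinearMap.sum_apply, hMv, ← hym]
      simp only [AlgHom.toLinearMap_apply, map_mul, he]
      push_cast
      exact sub_self _
    rw [Finset.sum_mul_sum, map_sum]
    refine Finset.sum_eq_zero fun i _ => ?_
    rw [map_sum]
    refine Finset.sum_eq_zero fun j _ => ?_
    rw [show C (α i) * realBasis i * (C (β j) * realBasis j)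
        = C (α i * β j) * (realBasis i * realBasis j) by rw [C_mul]; ring, C_mul', map_smul,
      hterm, smul_zero]
  rw [LinearMap.sub_apply, sub_eq_zero, LinearMap.sum_apply] at hzero
  exact hzero

/-- A real form of bidegree `(2, 2)` in the kernel has a real zero. -/
theorem exists_real_zero_of_annih (hL : IsPPTFunctional L) {p : BiPoly}
    (hp : p ∈ annih L 2 2 2 2) (hr : conjP p = p) :
    HasRealZero L ∨ ∃ e : Fin 2 → ℂ, e ≠ 0 ∧ evalAt e (star e) p = 0 := by
  by_contra! hcon
  obtain ⟨hno, hne⟩ := hcon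
  obtain ⟨n, e, he⟩ := exists_eq_sum_evalAt hL
  set φ : (Fin 2 → ℂ) → ℝ := fun e => (evalAt e (star e) p).re with hφ
  have hreal : ∀ e, evalAt e (star e) p = φ e := by
    intro e
    have := star_evalAt_of_real hr e (star e)
    rw [star_star] at this
    exact (Complex.conj_eq_iff_re.mp this).symm
  have hφ0 : ∀ e, e ≠ 0 → φ e ≠ 0 := fun e he0 h => hne e he0 (by rw [hreal, h]; simp)
  have hφz : φ 0 = 0 := by
    have := evalAt_smul hp.1 0 0 0 0
    rw [zero_smul] at this
    have h0 : evalAt 0 0 p = 0 := by simpa using this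
    simp only [hφ, star_zero, h0, Complex.zero_re]
  have hφc : Continuous φ := Complex.continuous_re.comp
    (continuous_evalAt continuous_id continuous_id.star p)
  -- Without real zeros φ has constant sign off the origin, but its values at the points e k sum to
  -- zero. Hence every e k is 0, L(|x₀⁴|²) = 0, and x₀⁴ is in the kernel.
  have hconn : IsPreconnected ({0}ᶜ : Set (Fin 2 → ℂ)) := by
    refine (isConnected_compl_singleton_of_one_lt_rank ?_ 0).isPreconnected
    rw [rank_fun, Complex.rank_real_complex]
    norm_num
  have hsum : ∑ k, φ (e k) = 0 := by
    have h1 := he p hp.1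
    rw [hp.2 _ (x0_pow_mul_y0_pow_mem 2 2)] at h1
    simp only [hreal] at h1
    exact_mod_cast h1.symm
  have hsign : ∀ a b, φ a < 0 → 0 < φ b → False := by
    intro a b ha hb
    have ha0 : a ≠ 0 := by rintro rfl; linarith
    have hb0 : b ≠ 0 := by rintro rfl; linarith
    obtain ⟨c, hc, hc0⟩ := hconn.intermediate_value (Set.mem_compl_singleton_iff.mpr ha0)
      (Set.mem_compl_singleton_iff.mpr hb0) hφc.continuousOn ⟨ha.le, hb.le⟩
    exact hφ0 c hc hc0
  have hzero : ∀ k, φ (e k) = 0 := by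
    by_cases hpos : ∃ k, 0 < φ (e k)
    · obtain ⟨k₀, hk₀⟩ := hpos
      have hnn : ∀ k, 0 ≤ φ (e k) := fun k => by
        by_contra! h; exact hsign _ _ h hk₀
      exact fun k => (Finset.sum_eq_zero_iff_of_nonneg fun k _ => hnn k).mp hsum k
        (Finset.mem_univ k)
    · push Not at hpos
      exact fun k => (Finset.sum_eq_zero_iff_of_nonpos fun k _ => hpos k).mp hsum k
        (Finset.mem_univ k)
  have hek : ∀ k, e k = 0 := fun k => by
    by_contra h; exact hφ0 _ h (hzero k)
  refine hno (hasRealZero_of_quartic hL (a := x₀ ^ 4) (pow_ne_zero _ (X_ne_zero _))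
    (mem_annih_of_norm_eq_zero hL rfl (x0_pow_mem 4) ?_))
  have h1 := he _ (x0_pow_mul_y0_pow_mem 2 2)
  have h2 : x₀ ^ 4 * conjP (x₀ ^ 4) = x₀ ^ 2 * y₀ ^ 2 * (x₀ ^ 2 * y₀ ^ 2) := by
    simp only [map_pow, conjP_x0]; ring
  rw [h2, h1]
  exact Finset.sum_eq_zero fun k _ => by simp [hek k]

/-! ### Case distinction by kernel dimensions -/

/-- `polyOf` as a linear map. -/
noncomputable def polyOfLin (m n : ℕ) : (Fin (m + 1) × Fin (n + 1) → ℂ) →ₗ[ℂ] BiPoly where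
  toFun := polyOf m n
  map_add' c d := by simp [polyOf, add_mul, Finset.sum_add_distrib]
  map_smul' r c := by simp [polyOf, Finset.smul_sum, smul_eq_C_mul, mul_assoc]

instance finite_annih (m n m' n' : ℕ) : Module.Finite ℂ (annih L m n m' n') := by
  have h : annih L m n m' n' ≤ LinearMap.range (polyOfLin m n) := by
    intro f hf
    obtain ⟨c, rfl⟩ := exists_eq_polyOf hf.1
    exact ⟨c, rfl⟩
  exact Submodule.finiteDimensional_of_le h

theorem exists_linearIndependent_of_le_finrank {V : Submodule ℂ BiPoly} [Module.Finite ℂ V] {k : ℕ}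
    (h : k ≤ Module.finrank ℂ V) :
    ∃ v : Fin k → BiPoly, (∀ a, v a ∈ V) ∧ LinearIndependent ℂ v := by
  refine ⟨fun a => Module.finBasis ℂ V (Fin.castLE h a), fun a => Submodule.coe_mem _, ?_⟩
  exact ((Module.finBasis ℂ V).linearIndependent.comp _ (Fin.castLE_injective h)).map'
    V.subtype V.ker_subtype

theorem eq_zero_of_finrank_eq_zero {V : Submodule ℂ BiPoly} [Module.Finite ℂ V]
    (h : Module.finrank ℂ V = 0) : ∀ f ∈ V, f = 0 := by
  rw [Submodule.finrank_eq_zero] at h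
  subst h
  simp

theorem exists_spanning_of_finrank_eq_one {V : Submodule ℂ BiPoly}
    (h : Module.finrank ℂ V = 1) : ∃ v ∈ V, v ≠ 0 ∧ ∀ f ∈ V, ∃ c : ℂ, f = C c * v := by
  obtain ⟨v, hv, hs⟩ := finrank_eq_one_iff'.mp h
  refine ⟨v, v.2, fun h0 => hv (Subtype.ext h0), fun f hf => ?_⟩
  obtain ⟨c, hc⟩ := hs ⟨f, hf⟩
  exact ⟨c, by rw [← smul_eq_C_mul]; exact (congrArg Subtype.val hc).symm⟩

/-- The kernel is stable under conjugation. If both f + f̄ and i(f - f̄) were multiples of p, so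
would f be; hence one of them completes p to a real basis. -/
theorem exists_real_basis_of_finrank_eq_two (hL : IsPPTFunctional L)
    (h : Module.finrank ℂ (annih L 2 2 2 2) = 2) :
    ∃ p ∈ annih L 2 2 2 2, ∃ q ∈ annih L 2 2 2 2, conjP p = p ∧ conjP q = q ∧
      LinearIndependent ℂ ![p, q] ∧
      ∀ f ∈ annih L 2 2 2 2, ∃ s t : ℂ, f = C s * p + C t * q := by
  obtain ⟨v, hv, hi⟩ := exists_linearIndependent_of_le_finrank h.ge
  obtain ⟨p, hp, hp0, hpr⟩ := exists_real_of_mem_annih hL (hi.ne_zero 0) (hv 0)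
  have hout : ∃ f ∈ annih L 2 2 2 2, f ∉ Submodule.span ℂ {p} := by
    by_contra! hc
    have h1 := Submodule.finrank_mono (show annih L 2 2 2 2 ≤ Submodule.span ℂ {p} from hc)
    rw [h, finrank_span_singleton hp0] at h1
    omega
  obtain ⟨f, hf, hfp⟩ := hout
  have hf' := conjP_mem_annih hL hf
  have hq : ∃ q ∈ annih L 2 2 2 2, conjP q = q ∧ q ∉ Submodule.span ℂ {p} := by
    by_cases h1 : f + conjP f ∈ Submodule.span ℂ {p}
    · refine ⟨C Complex.I * (f - conjP f), ?_, ?_, fun h2 => hfp ?_⟩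
      · rw [C_mul']; exact Submodule.smul_mem _ _ (sub_mem hf hf')
      · simp only [map_mul, conjP_C, Complex.conj_I, map_sub, conjP_conjP, C_neg]; ring
      · rw [C_mul', Submodule.smul_mem_iff _ Complex.I_ne_zero] at h2
        have h3 := Submodule.smul_mem _ (1 / 2 : ℂ) (add_mem h1 h2)
        rwa [show f + conjP f + (f - conjP f) = (2 : ℂ) • f by rw [two_smul]; ring, smul_smul,
          one_div, inv_mul_cancel₀ two_ne_zero, one_smul] at h3
    · exact ⟨f + conjP f, add_mem hf hf', by rw [map_add, conjP_conjP, add_comm], h1⟩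
  obtain ⟨q, hq, hqr, hqp⟩ := hq
  have hli : LinearIndependent ℂ ![p, q] := by
    rw [LinearIndependent.pair_iff' hp0]
    intro a ha
    exact hqp (Submodule.mem_span_singleton.mpr ⟨a, ha⟩)
  refine ⟨p, hp, q, hq, hpr, hqr, hli, fun f hf => ?_⟩
  have hle : Submodule.span ℂ (Set.range ![p, q]) ≤ annih L 2 2 2 2 := by
    rw [Submodule.span_le]
    rintro _ ⟨i, rfl⟩
    fin_cases i <;> assumption
  have heq := Submodule.eq_of_le_of_finrank_eq hle (by
    rw [finrank_span_eq_card hli, h]; rfl)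
  rw [← heq, Matrix.range_cons, Matrix.range_cons, Matrix.range_empty, Set.union_empty,
    Set.singleton_union, Submodule.mem_span_pair] at hf
  obtain ⟨s, t, hst⟩ := hf
  exact ⟨s, t, by rw [← hst, smul_eq_C_mul, smul_eq_C_mul]⟩

/-- A PPT functional has a real zero unless its annihilators in bidegrees `(4, 0)`, `(3, 1)`,
`(2, 2)` have dimensions `0, 1, 1` or `0, 1, 2`. -/
theorem hasRealZero_of_finrank (hL : IsPPTFunctional L)
    (h : Module.finrank ℂ (annih L 4 0 0 4) = 0 → Module.finrank ℂ (annih L 3 1 1 3) = 1 →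
      Module.finrank ℂ (annih L 2 2 2 2) ≠ 1 ∧ Module.finrank ℂ (annih L 2 2 2 2) ≠ 2) :
    HasRealZero L := by
  by_cases h40 : Module.finrank ℂ (annih L 4 0 0 4) = 0
  swap
  · obtain ⟨v, hv, hi⟩ := exists_linearIndependent_of_le_finrank (Nat.one_le_iff_ne_zero.mpr h40)
    exact hasRealZero_of_quartic hL (hi.ne_zero 0) (hv 0)
  have h4 := eq_zero_of_finrank_eq_zero h40
  by_cases h31 : 2 ≤ Module.finrank ℂ (annih L 3 1 1 3)
  · obtain ⟨v, hv, hi⟩ := exists_linearIndependent_of_le_finrank h31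
    exact hasRealZero_of_two_annih hL hv hi
  by_cases h22 : 3 ≤ Module.finrank ℂ (annih L 2 2 2 2)
  · obtain ⟨v, hv, hi⟩ := exists_linearIndependent_of_le_finrank h22
    exact hasRealZero_of_three_annih hL hv hi
  have h4e : ∀ e : Fin 2 → ℂ, ∀ f ∈ annih L 4 0 0 4, evalAt e (star e) f = 0 :=
    fun e f hf => by rw [h4 f hf, map_zero]
  obtain h31 | h31 : Module.finrank ℂ (annih L 3 1 1 3) = 0 ∨
      Module.finrank ℂ (annih L 3 1 1 3) = 1 := by omega
  · have h3 := eq_zero_of_finrank_eq_zero h31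
    have h3e : ∀ e : Fin 2 → ℂ, ∀ f ∈ annih L 3 1 1 3, evalAt e (star e) f = 0 :=
      fun e f hf => by rw [h3 f hf, map_zero]
    obtain h22 | h22 | h22 : Module.finrank ℂ (annih L 2 2 2 2) = 0 ∨
        Module.finrank ℂ (annih L 2 2 2 2) = 1 ∨ Module.finrank ℂ (annih L 2 2 2 2) = 2 := by omega
    · have h2 := eq_zero_of_finrank_eq_zero h22
      exact hasRealZero_of hL (e := 1) one_ne_zero (h4e _) (h3e _)
        fun f hf => by rw [h2 f hf, map_zero]
    · obtain ⟨v, hv, hv0, hs⟩ := exists_spanning_of_finrank_eq_one h22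
      obtain ⟨p, hp, hp0, hpr⟩ := exists_real_of_mem_annih hL hv0 hv
      obtain hz | ⟨e, he, hz⟩ := exists_real_zero_of_annih hL hp hpr
      · exact hz
      · obtain ⟨c, rfl⟩ := hs p hp
        have hc : c ≠ 0 := fun hc => hp0 (by rw [hc, C_0, zero_mul])
        rw [map_mul, evalAt_C, mul_eq_zero] at hz
        refine hasRealZero_of hL he (h4e _) (h3e _) fun f hf => ?_
        obtain ⟨d, rfl⟩ := hs f hf
        rw [map_mul, hz.resolve_left hc, mul_zero]
    · obtain ⟨p, hp, q, hq, hpr, hqr, hi, hs⟩ := exists_real_basis_of_finrank_eq_two hL h22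
      exact hasRealZero_of_pencil hL h4 h3 hp hq hpr hqr hi hs
  · have h22' := h h40 h31
    have h2 := eq_zero_of_finrank_eq_zero
      (show Module.finrank ℂ (annih L 2 2 2 2) = 0 by omega)
    obtain ⟨G, hG, hG0, hs⟩ := exists_spanning_of_finrank_eq_one h31
    obtain ⟨e, he, hz⟩ := exists_real_zero_three_one hG.1
    refine hasRealZero_of hL he (h4e _) (fun f hf => ?_) fun f hf => by rw [h2 f hf, map_zero]
    obtain ⟨d, rfl⟩ := hs f hf
    rw [map_mul, hz, mul_zero]

/-! ### From symmetric states to functionals -/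

/-- The functional on polynomials whose value at a monomial depends only on the exponents of
`x₁` and `y₁`. -/
noncomputable def momentFunctional (s : ℕ → ℕ → ℂ) : BiPoly →ₗ[ℂ] ℂ :=
  (basisMonomials (Fin 4) ℂ).constr ℂ fun d => s (d 1) (d 3)

theorem momentFunctional_monomial (s : ℕ → ℕ → ℂ) (d : Fin 4 →₀ ℕ) (c : ℂ) :
    momentFunctional s (monomial d c) = c * s (d 1) (d 3) := by
  have h : momentFunctional s (monomial d 1) = s (d 1) (d 3) := by
    have := (basisMonomials (Fin 4) ℂ).constr_basis ℂ (fun d => s (d 1) (d 3)) d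
    rwa [coe_basisMonomials] at this
  rw [← h, ← smul_eq_mul, ← map_smul, smul_monomial, smul_eq_mul, mul_one]

theorem momentFunctional_biMon (s : ℕ → ℕ → ℂ) (m n i j : ℕ) :
    momentFunctional s (biMon m n i j) = s i j := by
  rw [biMon_eq_monomial, momentFunctional_monomial, one_mul]
  rfl

theorem momentFunctional_conjP {s : ℕ → ℕ → ℂ} (hs : ∀ p q, starRingEnd ℂ (s p q) = s q p)
    (f : BiPoly) : momentFunctional s (conjP f) = starRingEnd ℂ (momentFunctional s f) := by
  induction f using MvPolynomial.induction_on' with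
  | monomial d c =>
    have h : (monomial d c : BiPoly) = C c * biMon (d 0 + d 1) (d 2 + d 3) (d 1) (d 3) := by
      rw [monomial_eq, biMon]
      simp [Finsupp.prod_fintype, Fin.prod_univ_four, mul_assoc]
    rw [h, map_mul conjP, conjP_C, conjP_biMon, map_C_mul, map_C_mul, momentFunctional_biMon,
      momentFunctional_biMon, map_mul, hs]
  | add p q hp hq => rw [map_add, map_add, map_add, map_add, hp, hq]

theorem biMon_mul_biMon {m n i j m' n' i' j' : ℕ} (hi : i ≤ m) (hj : j ≤ n) (hi' : i' ≤ m')
    (hj' : j' ≤ n') :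
    biMon m n i j * biMon m' n' i' j' = biMon (m + m') (n + n') (i + i') (j + j') := by
  simp only [biMon]
  rw [show m + m' - (i + i') = (m - i) + (m' - i') by omega,
    show n + n' - (j + j') = (n - j) + (n' - j') by omega]
  ring

/-- The Gram matrix of the form `(f, g) ↦ L (f * conjP g)` in the monomial basis. -/
noncomputable def gram (L : BiPoly →ₗ[ℂ] ℂ) (m n : ℕ) :
    Matrix (Fin (m + 1) × Fin (n + 1)) (Fin (m + 1) × Fin (n + 1)) ℂ :=
  fun p q => L (biMon m n p.1 p.2 * conjP (biMon m n q.1 q.2))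

theorem gram_momentFunctional (s : ℕ → ℕ → ℂ) (m n : ℕ) (p q : Fin (m + 1) × Fin (n + 1)) :
    gram (momentFunctional s) m n p q = s (p.1 + q.2) (p.2 + q.1) := by
  rw [gram, conjP_biMon, biMon_mul_biMon (by omega) (by omega) (by omega) (by omega),
    momentFunctional_biMon]

theorem map_polyOf_mul (L : BiPoly →ₗ[ℂ] ℂ) {m n : ℕ} (c : Fin (m + 1) × Fin (n + 1) → ℂ)
    (h : BiPoly) : L (polyOf m n c * h) = ∑ p, c p * L (biMon m n p.1 p.2 * h) := by
  rw [polyOf, Finset.sum_mul, map_sum]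
  exact Finset.sum_congr rfl fun p _ => by rw [mul_assoc, map_C_mul]

/-- The transpose arises because L(f ḡ) is linear in the coefficients of f, which are paired with
the row index of the Gram matrix. -/
theorem mem_annih_polyOf_iff (L : BiPoly →ₗ[ℂ] ℂ) {m n : ℕ}
    (c : Fin (m + 1) × Fin (n + 1) → ℂ) :
    polyOf m n c ∈ annih L m n n m ↔ (gram L m n).transpose.mulVec c = 0 := by
  have key : ∀ q, (gram L m n).transpose.mulVec c q
      = L (polyOf m n c * conjP (biMon m n q.1 q.2)) := by
    intro q
    rw [map_polyOf_mul]
    exact Finset.sum_congr rfl fun p _ => mul_comm _ _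
  constructor
  · intro h
    funext q
    rw [key, h.2 _ (conjP_mem (biMon_mem (by omega) (by omega)))]
    rfl
  · refine fun h => ⟨polyOf_mem c, fun g hg => ?_⟩
    induction hg using bihom_induction with
    | mon i j hi hj =>
      have h1 := key (⟨j, by omega⟩, ⟨i, by omega⟩)
      rw [h, conjP_biMon] at h1
      exact h1.symm
    | add f g _ _ h1 h2 => rw [mul_add, map_add, h1, h2, add_zero]
    | zero => rw [mul_zero, map_zero]
    | smul a f _ h => rw [mul_left_comm, map_C_mul, h, mul_zero]

theorem rank_gram_add_finrank_annih (L : BiPoly →ₗ[ℂ] ℂ) (m n : ℕ) :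
    (gram L m n).rank + Module.finrank ℂ (annih L m n n m) = (m + 1) * (n + 1) := by
  have h : annih L m n n m
      = (LinearMap.ker (gram L m n).transpose.mulVecLin).map (polyOfLin m n) := by
    ext f
    constructor
    · intro hf
      obtain ⟨c, rfl⟩ := exists_eq_polyOf hf.1
      exact ⟨c, (mem_annih_polyOf_iff L c).mp hf, rfl⟩
    · rintro ⟨c, hc, rfl⟩
      exact (mem_annih_polyOf_iff L c).mpr hc
  rw [h, ← Matrix.rank_transpose, Matrix.rank,
    ← (Submodule.equivMapOfInjective (polyOfLin m n) (polyOf_injective m n) _).finrank_eq,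
    LinearMap.finrank_range_add_finrank_ker]
  simp

theorem re_map_mul_conjP_nonneg {L : BiPoly →ₗ[ℂ] ℂ} {m n : ℕ} (h : (gram L m n).PosSemidef)
    {f : BiPoly} (hf : f ∈ bihom m n) : 0 ≤ (L (f * conjP f)).re := by
  obtain ⟨c, rfl⟩ := exists_eq_polyOf hf
  have h1 := (Matrix.posSemidef_iff_dotProduct_mulVec.mp h).2 (star c)
  have h2 : L (polyOf m n c * conjP (polyOf m n c))
      = dotProduct (star (star c)) ((gram L m n).mulVec (star c)) := by
    rw [map_polyOf_mul, star_star]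
    refine Finset.sum_congr rfl fun p _ => ?_
    congr 1
    rw [polyOf, map_sum, Finset.mul_sum, map_sum]
    refine Finset.sum_congr rfl fun q _ => ?_
    rw [map_mul conjP, conjP_C, mul_left_comm, map_C_mul, mul_comm]
    rfl
  rw [h2]
  exact (Complex.le_def.mp h1).1

/-- A vector orthogonal to the kernel of a Hermitian matrix is in its range. -/
theorem mem_range_of_forall_ker {ι : Type*} [Fintype ι] [DecidableEq ι] {A : Matrix ι ι ℂ}
    (hA : A.IsHermitian) {v : ι → ℂ} (h : ∀ c, A.mulVec c = 0 → dotProduct (star c) v = 0) :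
    v ∈ LinearMap.range A.mulVecLin := by
  by_contra hv
  obtain ⟨φ, hφv, hφ⟩ := Submodule.exists_le_ker_of_notMem hv
  set w : ι → ℂ := fun i => φ (Pi.single i 1) with hw
  have hφw : ∀ u, φ u = dotProduct w u := by
    intro u
    conv_lhs => rw [pi_eq_sum_univ' u, map_sum]
    refine Finset.sum_congr rfl fun i _ => ?_
    rw [map_smul, smul_eq_mul, mul_comm]
  apply hφv
  rw [hφw, ← star_star w]
  refine h _ ?_
  have h1 : Matrix.vecMul w A = 0 := by
    funext j
    have h2 : φ (A.mulVec (Pi.single j 1)) = 0 := hφ ⟨Pi.single j 1, rfl⟩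
    rw [hφw, Matrix.dotProduct_mulVec, dotProduct_single, mul_one] at h2
    exact h2
  have h3 := congrArg star h1
  rwa [Matrix.star_vecMul, hA.eq, star_zero] at h3

/-- The number of ones of a computational basis index at the parties in `T`. -/
def weight (T : Finset (Fin 4)) (i : Idx 4 2) : ℕ := ∑ k ∈ T, (i k).val

theorem weight_le (T : Finset (Fin 4)) (i : Idx 4 2) : weight T i ≤ T.card := by
  have h := Finset.sum_le_card_nsmul T (fun k => (i k).val) 1 fun k _ => by omega
  simpa [weight] using h

theorem prod_eq_pow_weight (T : Finset (Fin 4)) (a : Fin 2 → ℂ) (i : Idx 4 2) :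
    ∏ k ∈ T, a (i k) = a 0 ^ (T.card - weight T i) * a 1 ^ weight T i := by
  induction T using Finset.induction_on with
  | empty => simp [weight]
  | insert k T hk ih =>
    have hw := weight_le T i
    have h1 : weight (insert k T) i = (i k).val + weight T i := Finset.sum_insert hk
    rw [Finset.prod_insert hk, ih, h1, Finset.card_insert_of_notMem hk]
    obtain h | h : i k = 0 ∨ i k = 1 := by omega
    · rw [h, show T.card + 1 - ((0 : Fin 2).val + weight T i) = T.card - weight T i + 1 by
        simp; omega]
      simp only [Fin.val_zero, zero_add]
      ring
    · rw [h, show T.card + 1 - ((1 : Fin 2).val + weight T i) = T.card - weight T i by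
        simp; omega]
      simp only [Fin.val_one]
      ring

/-- The bidegree in `(x₁, y₁)` of the monomial belonging to a basis index, the parties in `S`
carrying the variables `y`. -/
def bidegree (S : Finset (Fin 4)) (i : Idx 4 2) : Fin (Sᶜ.card + 1) × Fin (S.card + 1) :=
  (⟨weight Sᶜ i, Nat.lt_succ_of_le (weight_le _ _)⟩, ⟨weight S i, Nat.lt_succ_of_le (weight_le _ _)⟩)

theorem bidegree_surjective (S : Finset (Fin 4)) : Function.Surjective (bidegree S) := by
  rintro ⟨p, q⟩
  obtain ⟨U, hU, hUp⟩ := Finset.exists_subset_card_eq (Nat.le_of_lt_succ p.2)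
  obtain ⟨V, hV, hVq⟩ := Finset.exists_subset_card_eq (Nat.le_of_lt_succ q.2)
  have hw : ∀ T : Finset (Fin 4), weight T (fun k => if k ∈ U ∪ V then 1 else 0)
      = (T ∩ (U ∪ V)).card := by
    intro T
    rw [weight, ← Finset.filter_mem_eq_inter, Finset.card_filter]
    exact Finset.sum_congr rfl fun k _ => by split_ifs <;> rfl
  have h1 : Sᶜ ∩ (U ∪ V) = U := by
    ext k
    have h2 := @hU k
    have h3 := @hV k
    simp only [Finset.mem_inter, Finset.mem_compl, Finset.mem_union] at h2 ⊢
    tauto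
  have h4 : S ∩ (U ∪ V) = V := by
    ext k
    have h2 := @hU k
    have h3 := @hV k
    simp only [Finset.mem_inter, Finset.mem_compl, Finset.mem_union] at h2 ⊢
    tauto
  refine ⟨fun k => if k ∈ U ∪ V then 1 else 0, Prod.ext (Fin.ext ?_) (Fin.ext ?_)⟩
  · exact (hw _).trans (by rw [h1, hUp])
  · exact (hw _).trans (by rw [h4, hVq])

theorem evalAt_biMon_bidegree (S : Finset (Fin 4)) (e : Fin 2 → ℂ) (i : Idx 4 2) :
    evalAt e (star e) (biMon Sᶜ.card S.card (bidegree S i).1 (bidegree S i).2)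
      = prodVec (conjOn S fun _ => e) i := by
  have h1 : prodVec (conjOn S fun _ => e) i = (∏ k ∈ Sᶜ, e (i k)) * ∏ k ∈ S, star e (i k) := by
    rw [prodVec, ← Finset.prod_compl_mul_prod S]
    congr 1
    · exact Finset.prod_congr rfl fun k hk => by
        rw [conjOn, if_neg (Finset.mem_compl.mp hk)]
    · exact Finset.prod_congr rfl fun k hk => by rw [conjOn, if_pos hk]
  rw [h1, prod_eq_pow_weight, prod_eq_pow_weight, biMon]
  simp only [map_mul, map_pow, evalAt_x0, evalAt_x1, evalAt_y0, evalAt_y1]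
  rfl

/-- The basis index with `p` ones followed by zeros. -/
def sortedIdx (p : ℕ) : Idx 4 2 := fun k => if k.val < p then 1 else 0

theorem exists_perm_eq_sortedIdx :
    ∀ i : Idx 4 2, ∃ π : Equiv.Perm (Fin 4), i ∘ π = sortedIdx (weight Finset.univ i) := by
  decide +kernel

variable {ρ : Op 4 2}

/-- The matrix entries of `ρ` at sorted indices. -/
def entry (ρ : Op 4 2) (p q : ℕ) : ℂ := ρ (sortedIdx p) (sortedIdx q)

/-- Columns of ρ lie in its range, hence are permutation symmetric; Hermiticity transfers this to
rows. -/
theorem apply_eq_entry (hρ : ρ.IsHermitian) (hs : IsSymm ρ) (i j : Idx 4 2) :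
    ρ i j = entry ρ (weight Finset.univ i) (weight Finset.univ j) := by
  have hcol : ∀ (π : Equiv.Perm (Fin 4)) (i j : Idx 4 2), ρ (i ∘ π) j = ρ i j := by
    intro π i j
    have h := hs ⟨Pi.single j 1, rfl⟩ π i
    rwa [Matrix.mulVecLin_apply, Matrix.mulVec_single_one] at h
  have hrow : ∀ (π : Equiv.Perm (Fin 4)) (i j : Idx 4 2), ρ i (j ∘ π) = ρ i j := by
    intro π i j
    rw [← hρ.apply, hcol, hρ.apply]
  obtain ⟨π, hπ⟩ := exists_perm_eq_sortedIdx i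
  obtain ⟨τ, hτ⟩ := exists_perm_eq_sortedIdx j
  rw [entry, ← hπ, ← hτ, hcol, hrow]

/-- After the exchange on S the row index has weight `weight Sᶜ i + weight S j`, and the column
index the same with i and j exchanged. These are the exponents of x₁ and y₁ in the product of the
monomial of i with the conjugate monomial of j. -/
theorem partialTranspose_eq_submatrix (hρ : ρ.IsHermitian) (hs : IsSymm ρ) (S : Finset (Fin 4)) :
    partialTranspose S ρ = (gram (momentFunctional (entry ρ)) Sᶜ.card S.card).submatrix
      (bidegree S) (bidegree S) := by
  ext i j
  have h : ∀ i j : Idx 4 2, weight Finset.univ (fun k => if k ∈ S then j k else i k)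
      = weight Sᶜ i + weight S j := by
    intro i j
    rw [weight, ← Finset.sum_compl_add_sum S]
    congr 1
    · exact Finset.sum_congr rfl fun k hk => by rw [if_neg (Finset.mem_compl.mp hk)]
    · exact Finset.sum_congr rfl fun k hk => by rw [if_pos hk]
  rw [Matrix.submatrix_apply, gram_momentFunctional, partialTranspose, apply_eq_entry hρ hs, h, h,
    add_comm (weight Sᶜ j)]
  rfl

theorem gram_eq_submatrix (hρ : ρ.IsHermitian) (hs : IsSymm ρ) (S : Finset (Fin 4)) :
    gram (momentFunctional (entry ρ)) Sᶜ.card S.card = (partialTranspose S ρ).submatrix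
      (Function.surjInv (bidegree_surjective S)) (Function.surjInv (bidegree_surjective S)) := by
  rw [partialTranspose_eq_submatrix hρ hs, Matrix.submatrix_submatrix]
  ext p q
  simp

theorem rank_partialTranspose (hρ : ρ.IsHermitian) (hs : IsSymm ρ) (S : Finset (Fin 4)) :
    (partialTranspose S ρ).rank + Module.finrank ℂ
      (annih (momentFunctional (entry ρ)) Sᶜ.card S.card S.card Sᶜ.card)
      = (Sᶜ.card + 1) * (S.card + 1) := by
  have h : (partialTranspose S ρ).rank = (gram (momentFunctional (entry ρ)) Sᶜ.card S.card).rank := by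
    apply le_antisymm
    · rw [partialTranspose_eq_submatrix hρ hs]
      exact Matrix.rank_submatrix_le _ _ _
    · rw [gram_eq_submatrix hρ hs]
      exact Matrix.rank_submatrix_le _ _ _
  rw [h, rank_gram_add_finrank_annih]

/-- Bidegree (m,n) is realised by any set S of n parties, and trace one prevents the functional from
vanishing on bidegree (4,4). -/
theorem isPPTFunctional_momentFunctional (hρ : IsPPT ρ) (hs : IsSymm ρ) :
    IsPPTFunctional (momentFunctional (entry ρ)) where
  conj := momentFunctional_conjP fun p q => hρ.1.1.1.apply _ _
  nonneg := by
    intro m n f hmn hf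
    obtain ⟨S, -, hS⟩ := Finset.exists_subset_card_eq
      (show n ≤ (Finset.univ : Finset (Fin 4)).card by rw [Finset.card_fin]; omega)
    obtain rfl : Sᶜ.card = m := by rw [Finset.card_compl, Fintype.card_fin]; omega
    subst hS
    refine re_map_mul_conjP_nonneg ?_ hf
    rw [gram_eq_submatrix hρ.1.1.1 hs]
    exact (hρ.2 S).submatrix _
  nonzero := by
    by_contra! h
    have h0 : ρ.trace = 0 := by
      refine Finset.sum_eq_zero fun i _ => ?_
      rw [Matrix.diag_apply, apply_eq_entry hρ.1.1.1 hs,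
        ← momentFunctional_biMon (entry ρ) 4 4]
      exact h _ (biMon_mem (weight_le _ _) (weight_le _ _))
    exact one_ne_zero (hρ.1.2.symm.trans h0)

/-- The range of a Hermitian matrix is the orthogonal complement of its kernel. A kernel vector c,
with conjugated entries and indices collected by bidegree, becomes a kernel form of L whose value at
(e, ē) is the inner product of c with the product vector. -/
theorem exists_prodVec_mem_rangeOf (hρ : IsPPT ρ) (hs : IsSymm ρ)
    (h : HasRealZero (momentFunctional (entry ρ))) :
    ∃ e : Fin 2 → ℂ, e ≠ 0 ∧ ∀ S : Finset (Fin 4),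
      prodVec (conjOn S fun _ => e) ∈ rangeOf (partialTranspose S ρ) := by
  obtain ⟨e, he, hz⟩ := h
  refine ⟨e, he, fun S => mem_range_of_forall_ker (hρ.2 S).1 fun c hc => ?_⟩
  set f : BiPoly := ∑ i, C (star (c i)) *
    biMon Sᶜ.card S.card (bidegree S i).1 (bidegree S i).2 with hf
  have hcS : Sᶜ.card + S.card = 4 := by
    rw [Finset.card_compl, Fintype.card_fin]; have := S.card_le_univ; simp at this; omega
  have hfe : evalAt e (star e) f = dotProduct (star c) (prodVec (conjOn S fun _ => e)) := by
    rw [hf, map_sum]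
    exact Finset.sum_congr rfl fun i _ => by
      rw [map_mul, evalAt_C, evalAt_biMon_bidegree, Pi.star_apply]
  rw [← hfe]
  refine hz _ _ hcS f ⟨sum_mem fun i _ => C_mul_mem _ (biMon_mem (by omega) (by omega)), ?_⟩
  intro g hg
  induction hg using bihom_induction with
  | mon p q hp hq =>
    obtain ⟨j, hj⟩ := bidegree_surjective S (⟨q, by omega⟩, ⟨p, by omega⟩)
    have h1 : biMon S.card Sᶜ.card p q
        = conjP (biMon Sᶜ.card S.card (bidegree S j).1 (bidegree S j).2) := by
      rw [hj, conjP_biMon]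
    have h2 := congrArg star (congrFun hc j)
    rw [Pi.zero_apply, star_zero, Matrix.mulVec, dotProduct, star_sum] at h2
    rw [h1, hf, Finset.sum_mul, map_sum, ← h2]
    refine Finset.sum_congr rfl fun i _ => ?_
    rw [mul_assoc, map_C_mul, star_mul, mul_comm, mul_comm (star (c i)), (hρ.2 S).1.apply,
      partialTranspose_eq_submatrix hρ.1.1.1 hs]
    rfl
  | add f g _ _ h1 h2 => rw [mul_add, map_add, h1, h2, add_zero]
  | zero => rw [mul_zero, map_zero]
  | smul a f _ h => rw [mul_left_comm, map_C_mul, h, mul_zero]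

/-! ### Conclusion for states -/

/-- A four-qubit PPT symmetric state whose three-rank is neither `(5, 7, 7)` nor `(5, 7, 8)` is not
edge, and has a symmetric product vector. -/
theorem not_isEdge_and_hasSymProductVector (hρ : IsPPT ρ) (hs : IsSymm ρ)
    (h7 : threeRank ρ ≠ (5, 7, 7)) (h8 : threeRank ρ ≠ (5, 7, 8)) :
    ¬ IsEdge ρ ∧ HasSymProductVector ρ := by
  have hz : HasRealZero (momentFunctional (entry ρ)) := by
    refine hasRealZero_of_finrank (isPPTFunctional_momentFunctional hρ hs) fun h40 h31 => ?_
    have r4 : ρ.rank + Module.finrank ℂ (annih (momentFunctional (entry ρ)) 4 0 0 4) = 5 :=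
      rank_partialTranspose hρ.1.1.1 hs ∅
    have r3 : (partialTranspose {0} ρ).rank
        + Module.finrank ℂ (annih (momentFunctional (entry ρ)) 3 1 1 3) = 8 :=
      rank_partialTranspose hρ.1.1.1 hs {0}
    have r2 : (partialTranspose {0, 1} ρ).rank
        + Module.finrank ℂ (annih (momentFunctional (entry ρ)) 2 2 2 2) = 9 :=
      rank_partialTranspose hρ.1.1.1 hs {0, 1}
    constructor
    · intro h22
      exact h8 (Prod.ext (by dsimp [threeRank]; omega)
        (Prod.ext (by dsimp [threeRank]; omega) (by dsimp [threeRank]; omega)))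
    · intro h22
      exact h7 (Prod.ext (by dsimp [threeRank]; omega)
        (Prod.ext (by dsimp [threeRank]; omega) (by dsimp [threeRank]; omega)))
  obtain ⟨e, he, h⟩ := exists_prodVec_mem_rangeOf hρ hs hz
  refine ⟨fun hE => hE.2 ⟨fun _ => e, fun _ => he, h⟩, e, he, ?_, ?_, ?_⟩
  · have h0 : (conjOn ∅ fun _ => e) = ![e, e, e, e] := by
      funext k
      fin_cases k <;> simp [conjOn]
    have h1 := h ∅
    rwa [h0] at h1
  · have h0 : (conjOn {0} fun _ => e) = ![star e, e, e, e] := by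
      funext k
      fin_cases k <;> simp [conjOn]
    exact h0 ▸ h {0}
  · have h0 : (conjOn {0, 1} fun _ => e) = ![star e, star e, e, e] := by
      funext k
      fin_cases k <;> simp [conjOn]
    exact h0 ▸ h {0, 1}

end QSym

theorem theorem2 :
    (∀ t : ℕ × ℕ × ℕ, t ≠ (5, 7, 7) → t ≠ (5, 7, 8) →
      QSym.HoldsGenerically (QSym.pptSymOfRank t)
        (fun ρ => ¬ QSym.IsEdge ρ ∧ QSym.HasSymProductVector ρ)) ∧
    (∀ ρ ∈ QSym.pptSymOfRank (5, 8, 8),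
      ¬ QSym.IsEdge ρ ∧ QSym.HasSymProductVector ρ) := by
  have main : ∀ t : ℕ × ℕ × ℕ, t ≠ (5, 7, 7) → t ≠ (5, 7, 8) → ∀ ρ ∈ QSym.pptSymOfRank t,
      ¬ QSym.IsEdge ρ ∧ QSym.HasSymProductVector ρ := by
    rintro t h7 h8 ρ ⟨hρ, hs, rfl⟩
    exact QSym.not_isEdge_and_hasSymProductVector hρ hs h7 h8
  -- The conclusion holds on all of Σ_t, so the constant polynomial 1 witnesses genericity.
  refine ⟨fun t h7 h8 => ⟨1, fun ρ hρ => subset_closure ⟨hρ, ?_⟩,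
    fun ρ hρ _ => main t h7 h8 ρ hρ⟩, main _ (by decide) (by decide)⟩
  rw [QSym.EntryPoly.at, map_one]
  exact one_ne_zero
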